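/- Let $M$ be a connected smooth manifold, $\omega$ a 2-plectic form on $M$ (a closed 3-form such that $v\mapsto i_v\omega$ is injective on each tangent space), $\mathfrak g$ a finite-dimensional real Lie algebra, and $\mathfrak g\to\mathfrak X(M)$, $x\mapsto v_x$, a Lie algebra morphism with values in Hamiltonian vector fields, i.e. for every $x$ there is a 1-form $\alpha$ with $d\alpha=-i_{v_x}\omega$. Fix $p\in M$ and assume $H^1(M)=0$ (de Rham cohomology). *Definitions.* A Lie 2-algebra $L=\mathfrak h[1]\oplus\mathfrak g$ is an $L_\infty$-algebra concentrated in degrees $-1,0$ (with $\mathfrak h$ a finite-dimensional vector space); it is minimal if its unary bracket vanishes. Its binary bracket is always assumed to extend the given Lie bracket of $\mathfrak g$. Let $L_\infty(M,\omega)$ be the Lie 2-algebra with degree $0$ part the Hamiltonian 1-forms, degree $-1$ part $C^\infty(M)$, unary bracket $d$, and $[\alpha,\beta]'=i(v_\alpha\wedge v_\beta)\omega=\omega(v_\alpha,v_\beta,\cdot)$, $[\alpha,\beta,\gamma]'=-\omega(v_\alpha,v_\beta,v_\gamma)$ on Hamiltonian 1-forms, where $d\alpha=-i_{v_\alpha}\omega$;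 all other brackets are zero. A moment map for $L$ is an $L_\infty$-morphism $\mu=(\mu_1|_{\mathfrak g},\mu_1|_{\mathfrak h},\mu_2)\colon L\to L_\infty(M,\omega)$ with $d(\mu_1(x))=-i_{v_x}\omega$ for all $x\in\mathfrak g$. Two moment maps $\mu,\mu'$ for a minimal $L$ are inner equivalent if there is a linear map $\alpha\colon\mathfrak g\to C^\infty(M)$ such that, for all $x,y\in\mathfrak g$ and $a\in\mathfrak h$, $\mu_1(x)-\mu_1'(x)=-d(\alpha(x))$, $\mu_1(a)=\mu'_1(a)$ and $\mu_2(x,y)-\mu_2'(x,y)=-\alpha([x,y])$; that is, $\mu-\mu'=d_{tot}\alpha$ in the total complex of $CE(L)\otimes\Omega(M)$. Put $\omega_{3p}(x,y,z)=\omega(v_x,v_y,v_z)|_p$, and let $\mathbb R[1]\oplus_{-\omega_{3p}}\mathfrak g$ denote $\mathbb R[1]\oplus\mathfrak g$ with the Lie bracket of $\mathfrak g$, trinary bracket $-\omega_{3p}$, and all other brackets zero. *Claim.* $\mathbb R[1]\oplus_{-\omega_{3p}}\mathfrak g$ is a Lie 2-algebra, and there are linear maps $\gamma_1\colon\mathfrak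 g\to\Omega^1(M)$ with $d(\gamma_1(x))=-i_{v_x}\omega$ for all $x$. For every such $\gamma_1$ there is a moment map $\gamma$ for $\mathbb R[1]\oplus_{-\omega_{3p}}\mathfrak g$ that restricts to $\gamma_1$ on $\mathfrak g$, sends $r\in\mathbb R$ to the constant function $r$, and whose component $\gamma_2$ satisfies $d(\gamma_2(x,y))=\gamma_1([x,y])-i(v_x\wedge v_y)\omega$ and $\gamma_2(x,y)(p)=0$; and this $\gamma$ is universal in the following sense. For every minimal Lie 2-algebra $L=\mathfrak h[1]\oplus\mathfrak g$ and every moment map $\mu$ for $L$ there is an $L_\infty$-morphism $f\colon L\to\mathbb R[1]\oplus_{-\omega_{3p}}\mathfrak g$ with $f_1|_{\mathfrak g}=\mathrm{Id}_{\mathfrak g}$ such that $\gamma\circ f$ is a moment map for $L$ which is inner equivalent to $\mu$. -/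

import Mathlib

open scoped Manifold ContDiff

namespace TwoPlectic

noncomputable section

/-! ### Lie 2-algebras -/

/-- The brackets of a Lie 2-algebra with underlying graded vector space `h[1] ⊕ g`: the unary
bracket `δ : h → g`, the binary brackets `[x, y] = br x y` and `[x, a] = act x a = -[a, x]`, and the
trinary bracket `tri` (for `x, y` in `g` and `a` in `h`). The higher Jacobi identities are
`IsLie2Algebra`. -/
structure Lie2Brackets (g h : Type*) [AddCommGroup g] [Module ℝ g] [AddCommGroup h]
    [Module ℝ h] where
  δ : h →ₗ[ℝ] g
  br : g →ₗ[ℝ] g →ₗ[ℝ] g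
  act : g →ₗ[ℝ] h →ₗ[ℝ] h
  tri : g [⋀^Fin 3]→ₗ[ℝ] h

section Algebra

variable {g h g' h' : Type*} [AddCommGroup g] [Module ℝ g] [AddCommGroup h] [Module ℝ h]
  [AddCommGroup g'] [Module ℝ g'] [AddCommGroup h'] [Module ℝ h']

/-- The axioms of an `L_∞`-algebra concentrated in degrees `0` and `-1`. -/
structure Lie2Brackets.IsLie2Algebra (L : Lie2Brackets g h) : Prop where
  br_self : ∀ x, L.br x x = 0
  δ_act : ∀ x a, L.δ (L.act x a) = L.br x (L.δ a)
  act_δ : ∀ a b, L.act (L.δ a) b = -L.act (L.δ b) a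
  δ_tri : ∀ x y z,
    L.δ (L.tri ![x, y, z]) = L.br x (L.br y z) + L.br y (L.br z x) + L.br z (L.br x y)
  tri_δ : ∀ x y a,
    L.tri ![x, y, L.δ a] = L.act x (L.act y a) - L.act y (L.act x a) - L.act (L.br x y) a
  tri_cocycle : ∀ x y z u,
    L.act x (L.tri ![y, z, u]) - L.act y (L.tri ![x, z, u])
        + L.act z (L.tri ![x, y, u]) - L.act u (L.tri ![x, y, z]) =
      L.tri ![L.br x y, z, u] + L.tri ![y, L.br x z, u] + L.tri ![y, z, L.br x u]
        - L.tri ![x, L.br y z, u] - L.tri ![x, z, L.br y u] + L.tri ![x, y, L.br z u]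

/-- A Lie 2-algebra is minimal if its unary bracket vanishes. -/
def Lie2Brackets.IsMinimal (L : Lie2Brackets g h) : Prop := L.δ = 0

/-- An `L_∞`-morphism `(f₁, f₂)` between Lie 2-algebras; `f₁` has the components
`f1g : g → g'` and `f1h : h → h'`, and `f2` maps `∧²g` to `h'`. -/
structure Lie2Hom (L : Lie2Brackets g h) (L' : Lie2Brackets g' h') where
  f1g : g →ₗ[ℝ] g'
  f1h : h →ₗ[ℝ] h'
  f2 : g [⋀^Fin 2]→ₗ[ℝ] h'
  map_δ : ∀ a, L'.δ (f1h a) = f1g (L.δ a)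
  map_br : ∀ x y, L'.δ (f2 ![x, y]) = f1g (L.br x y) - L'.br (f1g x) (f1g y)
  map_act : ∀ a x, f2 ![L.δ a, x] = f1h (-L.act x a) - (-L'.act (f1g x) (f1h a))
  map_tri : ∀ x y z,
    f1h (L.tri ![x, y, z]) - L'.tri ![f1g x, f1g y, f1g z] =
      f2 ![x, L.br y z] - f2 ![y, L.br x z] + f2 ![z, L.br x y]
        + L'.act (f1g x) (f2 ![y, z]) - L'.act (f1g y) (f2 ![x, z])
        + L'.act (f1g z) (f2 ![x, y])

end Algebra

/-! ### Differential forms -/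

section Manifold

variable (E M : Type*) [NormedAddCommGroup E] [NormedSpace ℝ E]
  [TopologicalSpace M] [ChartedSpace E M] [IsManifold 𝓘(ℝ, E) ∞ M]

/-- Smooth real functions on `M`. -/
abbrev SmoothFun := C^∞⟮𝓘(ℝ, E), M; ℝ⟯

/-- Smooth vector fields on `M`. -/
abbrev VField := ContMDiffSection 𝓘(ℝ, E) E ∞ (fun x : M => TangentSpace 𝓘(ℝ, E) x)

/-- Smooth differential `k`-forms on `M`: smooth sections of the bundle of alternating
`k`-linear forms on the tangent spaces. -/
abbrev DForm (k : ℕ) := ContMDiffSection 𝓘(ℝ, E) (E [⋀^Fin k]→L[ℝ] ℝ) ∞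
  (fun x : M => TangentSpace 𝓘(ℝ, E) x [⋀^Fin k]→L[ℝ] Bundle.Trivial M ℝ x)

variable {E M}

/-- The form `α` in the chart at `q`, i.e. the pullback of `α` by the inverse of that chart. -/
def chartForm {k : ℕ} (α : DForm E M k) (q : M) (y : E) : E [⋀^Fin k]→L[ℝ] ℝ :=
  (α ((extChartAt 𝓘(ℝ, E) q).symm y)).compContinuousLinearMap
    (mfderiv 𝓘(ℝ, E) 𝓘(ℝ, E) (extChartAt 𝓘(ℝ, E) q).symm y :
      E →L[ℝ] TangentSpace 𝓘(ℝ, E) ((extChartAt 𝓘(ℝ, E) q).symm y))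

/-- The value of the de Rham differential `dα` at `q`, computed in the chart at `q`. -/
def dR {k : ℕ} (α : DForm E M k) (q : M) : TangentSpace 𝓘(ℝ, E) q [⋀^Fin (k + 1)]→L[ℝ] ℝ :=
  (extDeriv (chartForm α q) (extChartAt 𝓘(ℝ, E) q q)).compContinuousLinearMap
    (mfderiv 𝓘(ℝ, E) 𝓘(ℝ, E) (extChartAt 𝓘(ℝ, E) q) q : TangentSpace 𝓘(ℝ, E) q →L[ℝ] E)

/-- The differential `df` of a smooth function, as a `1`-form, at `q`. -/
def dFun (f : SmoothFun E M) (q : M) : TangentSpace 𝓘(ℝ, E) q [⋀^Fin 1]→L[ℝ] ℝ :=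
  ContinuousAlternatingMap.ofSubsingleton ℝ (TangentSpace 𝓘(ℝ, E) q) ℝ (0 : Fin 1)
    (mfderiv 𝓘(ℝ, E) 𝓘(ℝ, ℝ) f q : TangentSpace 𝓘(ℝ, E) q →L[ℝ] ℝ)

/-- The contraction `i_v ϖ`, at `q`. -/
def contract (ϖ : DForm E M 3) (v : VField E M) (q : M) :
    TangentSpace 𝓘(ℝ, E) q [⋀^Fin 2]→L[ℝ] ℝ :=
  ContinuousAlternatingMap.curryLeft (E := E) (F := ℝ) (ϖ q) (v q)

/-- The contraction `i(v ∧ w) ϖ = i_w i_v ϖ`, at `q`. -/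
def contract₂ (ϖ : DForm E M 3) (v w : VField E M) (q : M) :
    TangentSpace 𝓘(ℝ, E) q [⋀^Fin 1]→L[ℝ] ℝ :=
  ContinuousAlternatingMap.curryLeft (E := E) (F := ℝ) (contract ϖ v q) (w q)

/-- The contraction `i(v ∧ w ∧ u) ϖ = i_u i_w i_v ϖ = ϖ(v, w, u)`, at `q`. -/
def contract₃ (ϖ : DForm E M 3) (v w u : VField E M) (q : M) : ℝ :=
  ϖ q ![v q, w q, u q]

variable (E M) in
/-- `H¹(M) = 0` for de Rham cohomology: every closed `1`-form is exact. -/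
def FirstDeRhamVanishes : Prop :=
  ∀ α : DForm E M 1, (∀ q, dR α q = 0) → ∃ f : SmoothFun E M, ∀ q, α q = dFun f q

/-! ### 2-plectic forms, Hamiltonian forms and actions -/

/-- `ϖ` is a 2-plectic form: closed and nondegenerate. -/
structure IsTwoPlectic (ϖ : DForm E M 3) : Prop where
  closed : ∀ q, dR ϖ q = 0
  nondegenerate : ∀ q, Function.Injective fun v : TangentSpace 𝓘(ℝ, E) q =>
    ContinuousAlternatingMap.curryLeft (E := E) (F := ℝ) (ϖ q) v

/-- `v` is a Hamiltonian vector field of the `1`-form `α`: `dα = -i_v ϖ`. -/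
def IsHamiltonianVF (ϖ : DForm E M 3) (α : DForm E M 1) (v : VField E M) : Prop :=
  ∀ q, dR α q = -contract ϖ v q

/-- A `1`-form is Hamiltonian if it has a Hamiltonian vector field. -/
def IsHamiltonian (ϖ : DForm E M 3) (α : DForm E M 1) : Prop :=
  ∃ v, IsHamiltonianVF ϖ α v

open Classical in
/-- The Hamiltonian vector field `v_α` of a Hamiltonian `1`-form `α` (unique when `ϖ` is
nondegenerate); zero if `α` is not Hamiltonian. -/
def hamVF (ϖ : DForm E M 3) (α : DForm E M 1) : VField E M :=
  if H : IsHamiltonian ϖ α then H.choose else 0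

/-- The binary bracket `[α, β]' = i(v_α ∧ v_β) ϖ` of `L_∞(M, ϖ)` on Hamiltonian `1`-forms. -/
def hamBr (ϖ : DForm E M 3) (α β : DForm E M 1) (q : M) :
    TangentSpace 𝓘(ℝ, E) q [⋀^Fin 1]→L[ℝ] ℝ :=
  contract₂ ϖ (hamVF ϖ α) (hamVF ϖ β) q

/-- The trinary bracket `[α, β, γ]' = -i(v_α ∧ v_β ∧ v_γ) ϖ` of `L_∞(M, ϖ)` on Hamiltonian
`1`-forms. -/
def hamTri (ϖ : DForm E M 3) (α β γ : DForm E M 1) (q : M) : ℝ :=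
  -contract₃ ϖ (hamVF ϖ α) (hamVF ϖ β) (hamVF ϖ γ) q

/-- `ρ : g → 𝔛(M)`, `x ↦ v_x`, is a morphism of Lie algebras with values in the Hamiltonian vector
fields. -/
structure IsHamiltonianAction {g : Type*} [LieRing g] [LieAlgebra ℝ g] (ϖ : DForm E M 3)
    (ρ : g →ₗ[ℝ] VField E M) : Prop where
  map_lie : ∀ (x y : g) (q : M),
    ρ ⁅x, y⁆ q = VectorField.mlieBracket 𝓘(ℝ, E) (fun m => ρ x m) (fun m => ρ y m) q
  hamiltonian : ∀ x, ∃ α : DForm E M 1, IsHamiltonianVF ϖ α (ρ x)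

/-! ### Moment maps -/

variable (E M) in
/-- The degree `2` part of the total complex of `CE(L) ⊗ Ω(M)`, for `L = h[1] ⊕ g`:
an element consists of linear maps `g → Ω¹(M)`, `h → C^∞(M)` and `∧²g → C^∞(M)`. -/
structure Cochain2 (g h : Type*) [AddCommGroup g] [Module ℝ g] [AddCommGroup h]
    [Module ℝ h] where
  m1g : g →ₗ[ℝ] DForm E M 1
  m1h : h →ₗ[ℝ] SmoothFun E M
  m2 : g [⋀^Fin 2]→ₗ[ℝ] SmoothFun E M

section Moment

variable {g h : Type*} [AddCommGroup g] [Module ℝ g] [AddCommGroup h] [Module ℝ h]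

/-- `μ` is a homotopy moment map for `L = h[1] ⊕ g`: it is an `L_∞`-morphism from `L` to
`L_∞(M, ϖ)`, with first component taking values in Hamiltonian `1`-forms, such that
`-i_{v_x} ϖ = d(μ₁ x)`. Note that all brackets of `L_∞(M, ϖ)` of two or more
elements, not all of degree `0`, vanish. -/
structure IsMomentMap (ϖ : DForm E M 3) (ρ : g →ₗ[ℝ] VField E M) (L : Lie2Brackets g h)
    (μ : Cochain2 E M g h) : Prop where
  hamiltonian : ∀ x, IsHamiltonian ϖ (μ.m1g x)
  map_δ : ∀ a q, dFun (μ.m1h a) q = μ.m1g (L.δ a) q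
  map_br : ∀ x y q,
    dFun (μ.m2 ![x, y]) q = μ.m1g (L.br x y) q - hamBr ϖ (μ.m1g x) (μ.m1g y) q
  map_act : ∀ a x, μ.m2 ![L.δ a, x] = μ.m1h (-L.act x a)
  map_tri : ∀ x y z q,
    μ.m1h (L.tri ![x, y, z]) q - hamTri ϖ (μ.m1g x) (μ.m1g y) (μ.m1g z) q =
      μ.m2 ![x, L.br y z] q - μ.m2 ![y, L.br x z] q + μ.m2 ![z, L.br x y] q
  moment : ∀ x q, -contract ϖ (ρ x) q = dR (μ.m1g x) q

/-- Two elements `μ, μ'` of `C²` are inner equivalent if `μ - μ' = d_tot α` for some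
`α ∈ C¹ = g[1]^* ⊗ C^∞(M)`. Here `d_tot = d_CE ⊗ 1 + 1 ⊗ d_dR` (with the Koszul sign) has the
components `(d_tot α)(x) = -d(α x)`, `(d_tot α)(a) = -α (δ a)` and
`(d_tot α)(x, y) = -α [x, y]`. -/
def InnerEquivalent (L : Lie2Brackets g h) (μ μ' : Cochain2 E M g h) : Prop :=
  ∃ α : g →ₗ[ℝ] SmoothFun E M,
    (∀ x q, μ.m1g x q - μ'.m1g x q = -dFun (α x) q) ∧
    (∀ a, μ.m1h a - μ'.m1h a = -α (L.δ a)) ∧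
    (∀ x y, μ.m2 ![x, y] - μ'.m2 ![x, y] = -α (L.br x y))

/-- `φ` is the composition `γ ∘ f` of the `L_∞`-morphisms `f : L → L'` and
`γ : L' → L_∞(M, ϖ)`. -/
structure IsComp {g' h' : Type*} [AddCommGroup g'] [Module ℝ g'] [AddCommGroup h'] [Module ℝ h']
    {L : Lie2Brackets g h} {L' : Lie2Brackets g' h'}
    (φ : Cochain2 E M g h) (γ : Cochain2 E M g' h') (f : Lie2Hom L L') : Prop where
  m1g : ∀ x, φ.m1g x = γ.m1g (f.f1g x)
  m1h : ∀ a, φ.m1h a = γ.m1h (f.f1h a)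
  m2 : ∀ x y, φ.m2 ![x, y] = γ.m1h (f.f2 ![x, y]) + γ.m2 ![f.f1g x, f.f1g y]

end Moment

/-! ### The Lie 2-algebra `ℝ[1] ⊕_{-ϖ_{3p}} g` -/

section Extension

variable {g : Type*} [LieRing g] [LieAlgebra ℝ g]

/-- `ϖ_{3p}(x, y, z) = ϖ(v_x, v_y, v_z)` at `p`. -/
def omega3 (ϖ : DForm E M 3) (ρ : g →ₗ[ℝ] VField E M) (p : M) : g [⋀^Fin 3]→ₗ[ℝ] ℝ :=
  AlternatingMap.compLinearMap (N := ℝ) (ϖ p).toAlternatingMap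
    { toFun := fun x => ρ x p
      map_add' := fun x y => by rw [map_add]; rfl
      map_smul' := fun c x => by rw [map_smul]; rfl }

/-- The brackets of `ℝ[1] ⊕_{-ϖ_{3p}} g`: the Lie bracket of `g`, the trinary bracket `-ϖ_{3p}`,
and all others zero. -/
def pointExt (ϖ : DForm E M 3) (ρ : g →ₗ[ℝ] VField E M) (p : M) : Lie2Brackets g ℝ where
  δ := 0
  br := (LieModule.toEnd ℝ g g : g →ₗ[ℝ] Module.End ℝ g)
  act := 0
  tri := -omega3 ϖ ρ p

/-- `γ` is the standard moment map for `ℝ[1] ⊕_{-ϖ_{3p}} g` built from `γ₁ : g → Ω¹(M)`: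
it restricts to `γ₁` on `g`, sends a real number `r` to the constant function `r`, and its
component `γ₂` satisfies `d(γ₂(x, y)) = γ₁[x, y] - i(v_x ∧ v_y) ϖ` and vanishes at `p`. -/
structure IsStandardMomentMap (ϖ : DForm E M 3) (ρ : g →ₗ[ℝ] VField E M) (p : M)
    (γ₁ : g →ₗ[ℝ] DForm E M 1) (γ : Cochain2 E M g ℝ) : Prop where
  isMomentMap : IsMomentMap ϖ ρ (pointExt ϖ ρ p) γ
  m1g : γ.m1g = γ₁
  m1h : ∀ (r : ℝ) (q : M), γ.m1h r q = r
  d_m2 : ∀ x y q, dFun (γ.m2 ![x, y]) q = γ₁ ⁅x, y⁆ q - contract₂ ϖ (ρ x) (ρ y) q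
  m2_base : ∀ x y, γ.m2 ![x, y] p = 0

end Extension

end Manifold

end

end TwoPlectic

/-!
The theorem rests on three facts about the vector fields `v_x`. Being Hamiltonian for a closed form
they preserve `ϖ`: `d (i_{v_x} ϖ) = -d d α = 0`, so that `L_{v_x} ϖ = 0` by Cartan's formula
(`lieDeriv_eq_zero`, `IsHamiltonianVF.dR_iota`). Since `x ↦ v_x` respects brackets, invariance gives

* `d (i(v_x ∧ v_y) ϖ) = -i_{v_[x, y]} ϖ` (`IsHamiltonianAction.dR_contract₂`);
* a formula for the differential of the function `ϖ(v_x, v_y, v_z)`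
  (`IsHamiltonianAction.dFun_contractFun`), and a second one for its derivative along some `v_u`;
  equating the two shows that `ϖ_{3p}` is a cocycle (`IsHamiltonianAction.omega3_cocycle`), which is
  the only nontrivial axiom of `ℝ[1] ⊕_{-ϖ_{3p}} g`.

By the first formula `γ₁[x, y] - i(v_x ∧ v_y) ϖ` is closed, and as `H¹(M) = 0` and `M` is connected
it has exactly one primitive `γ₂(x, y)` vanishing at `p`; uniqueness makes `γ₂` bilinear and
alternating (`exists_gamma_two`). The identity for the trinary bracket compares two functions which
have equal differentials by the second formula and which agree at `p` (`isMomentMap_standard`).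

Given a moment map `μ` for a minimal `L`, the closed forms `γ₁ x - μ₁ x` have primitives `α x`
depending linearly on `x`. Changing `μ` by `d_tot α` yields an inner equivalent moment map `φ` with
`φ₁ = γ₁` on `g`. Its component on `h` takes values in functions with zero differential, that is, in
constants, and `φ₂(x, y) - γ₂(x, y)` is constant as well. These constants are the components of the
morphism `f` with `φ = γ ∘ f` (`exists_factorization`).

The differential `dR` is computed at each point in the chart at that point. Compatibility with
transition maps (`chartForm_eq_pullback`) allows one fixed chart to be used near a point, where the
identities above reduce to identities between Fréchet derivatives in the model vector space.
-/

open scoped Topology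

namespace TwoPlectic

open Bundle

noncomputable section

/-! ### Calculus of 3-forms in a vector space -/

section VectorSpace

variable {E : Type*} [NormedAddCommGroup E] [NormedSpace ℝ E] {n : ℕ}

open ContinuousAlternatingMap

theorem hasFDerivAt_curryLeft_apply {F : E → E [⋀^Fin (n + 1)]→L[ℝ] ℝ} {u : E → E} {y : E}
    (hF : DifferentiableAt ℝ F y) (hu : DifferentiableAt ℝ u y) :
    HasFDerivAt (fun z => curryLeft (F z) (u z))
      ((curryLeft (F y)).comp (fderiv ℝ u y) +
        ((curryLeftLI (𝕜 := ℝ) (E := E) (F := ℝ) (n := n)).toContinuousLinearMap.comp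
          (fderiv ℝ F y)).flip (u y)) y := by
  have hL : HasFDerivAt (fun η : E [⋀^Fin (n + 1)]→L[ℝ] ℝ => curryLeft η)
      (curryLeftLI (𝕜 := ℝ) (E := E) (F := ℝ) (n := n)).toContinuousLinearMap (F y) :=
    (curryLeftLI (𝕜 := ℝ) (E := E) (F := ℝ) (n := n)).toContinuousLinearMap.hasFDerivAt
  have h : HasFDerivAt (fun z => curryLeft (F z)) _ y :=
    HasFDerivAt.comp (g := fun η : E [⋀^Fin (n + 1)]→L[ℝ] ℝ => curryLeft η) y hL
      hF.hasFDerivAt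
  exact h.clm_apply hu.hasFDerivAt

theorem differentiableAt_curryLeft_apply {F : E → E [⋀^Fin (n + 1)]→L[ℝ] ℝ} {u : E → E} {y : E}
    (hF : DifferentiableAt ℝ F y) (hu : DifferentiableAt ℝ u y) :
    DifferentiableAt ℝ (fun z => curryLeft (F z) (u z)) y :=
  (hasFDerivAt_curryLeft_apply hF hu).differentiableAt

theorem fderiv_curryLeft_apply {F : E → E [⋀^Fin (n + 1)]→L[ℝ] ℝ} {u : E → E} {y : E}
    (hF : DifferentiableAt ℝ F y) (hu : DifferentiableAt ℝ u y) (a : E) :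
    fderiv ℝ (fun z => curryLeft (F z) (u z)) y a =
      curryLeft (F y) (fderiv ℝ u y a) + curryLeft (fderiv ℝ F y a) (u y) := by
  rw [(hasFDerivAt_curryLeft_apply hF hu).fderiv]
  rfl

theorem extDeriv_apply_two (F : E → E [⋀^Fin 1]→L[ℝ] ℝ) (y a b : E) :
    extDeriv F y ![a, b] = fderiv ℝ F y a ![b] - fderiv ℝ F y b ![a] := by
  have h0 : Fin.removeNth 0 ![a, b] = ![b] := by ext i; fin_cases i; rfl
  have h1 : Fin.removeNth 1 ![a, b] = ![a] := by ext i; fin_cases i; rfl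
  simp [extDeriv, alternatizeUncurryFin_apply, Fin.sum_univ_succ, h0, h1, ← sub_eq_add_neg]

theorem extDeriv_apply_three (F : E → E [⋀^Fin 2]→L[ℝ] ℝ) (y a b c : E) :
    extDeriv F y ![a, b, c] =
      fderiv ℝ F y a ![b, c] - fderiv ℝ F y b ![a, c] + fderiv ℝ F y c ![a, b] := by
  have h0 : Fin.removeNth 0 ![a, b, c] = ![b, c] := by ext i; fin_cases i <;> rfl
  have h1 : Fin.removeNth 1 ![a, b, c] = ![a, c] := by ext i; fin_cases i <;> rfl
  have h2 : Fin.removeNth 2 ![a, b, c] = ![a, b] := by ext i; fin_cases i <;> rfl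
  simp [extDeriv, alternatizeUncurryFin_apply, Fin.sum_univ_succ, h0, h1, h2]
  ring

theorem extDeriv_apply_four (F : E → E [⋀^Fin 3]→L[ℝ] ℝ) (y a b c d : E) :
    extDeriv F y ![a, b, c, d] =
      fderiv ℝ F y a ![b, c, d] - fderiv ℝ F y b ![a, c, d] + fderiv ℝ F y c ![a, b, d]
        - fderiv ℝ F y d ![a, b, c] := by
  have h0 : Fin.removeNth 0 ![a, b, c, d] = ![b, c, d] := by ext i; fin_cases i <;> rfl
  have h1 : Fin.removeNth 1 ![a, b, c, d] = ![a, c, d] := by ext i; fin_cases i <;> rfl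
  have h2 : Fin.removeNth 2 ![a, b, c, d] = ![a, b, d] := by ext i; fin_cases i <;> rfl
  have h3 : Fin.removeNth 3 ![a, b, c, d] = ![a, b, c] := by ext i; fin_cases i <;> rfl
  simp [extDeriv, alternatizeUncurryFin_apply, Fin.sum_univ_succ, h0, h1, h2, h3]
  ring

theorem map_swap_left (η : E [⋀^Fin 3]→L[ℝ] ℝ) (a b c : E) : η ![b, a, c] = -η ![a, b, c] := by
  have h : η (![a, b, c] ∘ Equiv.swap 0 1) = -η ![a, b, c] :=
    η.toAlternatingMap.map_swap ![a, b, c] (by decide)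
  rw [← h]
  congr 1; ext i; fin_cases i <;> rfl

theorem map_swap_right (η : E [⋀^Fin 3]→L[ℝ] ℝ) (a b c : E) : η ![a, c, b] = -η ![a, b, c] := by
  have h : η (![a, b, c] ∘ Equiv.swap 1 2) = -η ![a, b, c] :=
    η.toAlternatingMap.map_swap ![a, b, c] (by decide)
  rw [← h]
  congr 1; ext i; fin_cases i <;> rfl

theorem map_sub_left (η : E [⋀^Fin 3]→L[ℝ] ℝ) (a a' b c : E) :
    η ![a - a', b, c] = η ![a, b, c] - η ![a', b, c] := by
  simp

/-- Cartan's formula in a vector space: if `Ω` and `i_u Ω` are closed then the Lie derivative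
`L_u Ω` vanishes. -/
theorem lieDeriv_eq_zero {Ω : E → E [⋀^Fin 3]→L[ℝ] ℝ} {u : E → E} {y : E}
    (hΩ : DifferentiableAt ℝ Ω y) (hu : DifferentiableAt ℝ u y) (dΩ : extDeriv Ω y = 0)
    (du : extDeriv (fun z => curryLeft (Ω z) (u z)) y = 0) (a b c : E) :
    fderiv ℝ Ω y (u y) ![a, b, c] + Ω y ![fderiv ℝ u y a, b, c] + Ω y ![a, fderiv ℝ u y b, c]
      + Ω y ![a, b, fderiv ℝ u y c] = 0 := by
  have h1 := extDeriv_apply_four Ω y (u y) a b c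
  have h2 := extDeriv_apply_three (fun z => curryLeft (Ω z) (u z)) y a b c
  rw [dΩ] at h1
  change (0 : ℝ) = _ at h1
  rw [du] at h2
  change (0 : ℝ) = _ at h2
  simp only [fderiv_curryLeft_apply hΩ hu, ContinuousAlternatingMap.add_apply, curryLeft_apply_apply] at h1 h2
  have s1 := map_swap_left (Ω y) a (fderiv ℝ u y b) c
  have s2 := map_swap_left (Ω y) a (fderiv ℝ u y c) b
  have s3 := map_swap_right (Ω y) a b (fderiv ℝ u y c)
  linarith

/-- For vector fields `v, w` preserving the closed form `Ω` one has
`d (i_w i_v Ω) = -i_{[v, w]} Ω`. -/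
theorem extDeriv_contract_contract {Ω : E → E [⋀^Fin 3]→L[ℝ] ℝ} {v w : E → E} {y : E}
    (hΩ : DifferentiableAt ℝ Ω y) (hv : DifferentiableAt ℝ v y) (hw : DifferentiableAt ℝ w y)
    (dΩ : extDeriv Ω y = 0)
    (dv : extDeriv (fun z => curryLeft (Ω z) (v z)) y = 0)
    (dw : extDeriv (fun z => curryLeft (Ω z) (w z)) y = 0) (a b : E) :
    extDeriv (fun z => curryLeft (curryLeft (Ω z) (v z)) (w z)) y ![a, b] =
      -Ω y ![VectorField.lieBracket ℝ v w y, a, b] := by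
  have hvΩ := differentiableAt_curryLeft_apply hΩ hv
  have h1 := extDeriv_apply_four Ω y (v y) (w y) a b
  rw [dΩ] at h1
  change (0 : ℝ) = _ at h1
  have h2 := lieDeriv_eq_zero hΩ hv dΩ dv (w y) a b
  have h3 := lieDeriv_eq_zero hΩ hw dΩ dw (v y) a b
  rw [extDeriv_apply_two]
  simp only [fderiv_curryLeft_apply hvΩ hw, fderiv_curryLeft_apply hΩ hv, ContinuousAlternatingMap.add_apply,
    curryLeft_apply_apply, curryLeft_add, _root_.add_apply,
    VectorField.lieBracket, map_sub_left] at h1 h2 h3 ⊢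
  have s1 := map_swap_left (Ω y) (w y) (fderiv ℝ v y a) b
  have s2 := map_swap_left (Ω y) (w y) (fderiv ℝ v y b) a
  have s3 := map_swap_right (Ω y) (w y) a (fderiv ℝ v y b)
  have s4 := map_swap_right (Ω y) (v y) a (fderiv ℝ w y b)
  linarith

/-- The derivative of the function `Ω(u, v, w)`. -/
theorem fderiv_eval_three {Ω : E → E [⋀^Fin 3]→L[ℝ] ℝ} {u v w : E → E} {y : E}
    (hΩ : DifferentiableAt ℝ Ω y) (hu : DifferentiableAt ℝ u y) (hv : DifferentiableAt ℝ v y)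
    (hw : DifferentiableAt ℝ w y) (a : E) :
    fderiv ℝ (fun z => Ω z ![u z, v z, w z]) y a =
      fderiv ℝ Ω y a ![u y, v y, w y] + Ω y ![fderiv ℝ u y a, v y, w y]
        + Ω y ![u y, fderiv ℝ v y a, w y] + Ω y ![u y, v y, fderiv ℝ w y a] := by
  have h1 := differentiableAt_curryLeft_apply hΩ hu
  have h2 := differentiableAt_curryLeft_apply h1 hv
  have h3 := differentiableAt_curryLeft_apply h2 hw
  have key := fderiv_curryLeft_apply h2 hw a
  rw [fderiv_curryLeft_apply h1 hv, fderiv_curryLeft_apply hΩ hu] at key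
  have e := fderiv_continuousAlternatingMap_apply_const_apply h3 ![] a
  rw [key] at e
  simp only [ContinuousAlternatingMap.add_apply, curryLeft_apply_apply, curryLeft_add, _root_.add_apply] at e
  rw [e]
  ring

/-- For a closed form `Ω` preserved by `u`, the derivative of `Ω(v, w, z)` along `u`. -/
theorem fderiv_eval_three_along {Ω : E → E [⋀^Fin 3]→L[ℝ] ℝ} {u v w t : E → E} {y : E}
    (hΩ : DifferentiableAt ℝ Ω y) (hu : DifferentiableAt ℝ u y) (hv : DifferentiableAt ℝ v y)
    (hw : DifferentiableAt ℝ w y) (ht : DifferentiableAt ℝ t y) (dΩ : extDeriv Ω y = 0)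
    (du : extDeriv (fun z => curryLeft (Ω z) (u z)) y = 0) :
    fderiv ℝ (fun z => Ω z ![v z, w z, t z]) y (u y) =
      Ω y ![VectorField.lieBracket ℝ u v y, w y, t y]
        + Ω y ![v y, VectorField.lieBracket ℝ u w y, t y]
        + Ω y ![v y, w y, VectorField.lieBracket ℝ u t y] := by
  rw [fderiv_eval_three hΩ hv hw ht]
  have h := lieDeriv_eq_zero hΩ hu dΩ du (v y) (w y) (t y)
  rw [map_swap_left _ (VectorField.lieBracket ℝ u w y), map_swap_right _ (v y) (VectorField.lieBracket ℝ u t y) (w y),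
    map_swap_left _ (VectorField.lieBracket ℝ u t y)]
  simp only [VectorField.lieBracket, map_sub_left]
  have s1 := map_swap_left (Ω y) (v y) (fderiv ℝ w y (u y)) (t y)
  have s2 := map_swap_left (Ω y) (v y) (fderiv ℝ u y (w y)) (t y)
  have s3 := map_swap_left (Ω y) (v y) (fderiv ℝ t y (u y)) (w y)
  have s4 := map_swap_right (Ω y) (v y) (w y) (fderiv ℝ t y (u y))
  have s5 := map_swap_left (Ω y) (v y) (fderiv ℝ u y (t y)) (w y)
  have s6 := map_swap_right (Ω y) (v y) (w y) (fderiv ℝ u y (t y))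
  linarith

/-- The differential of `Ω(u, v, w)`, for a closed form `Ω` preserved by `u, v, w`. -/
theorem fderiv_eval_three_of_closed {Ω : E → E [⋀^Fin 3]→L[ℝ] ℝ} {u v w : E → E} {y : E}
    (hΩ : DifferentiableAt ℝ Ω y) (hu : DifferentiableAt ℝ u y) (hv : DifferentiableAt ℝ v y)
    (hw : DifferentiableAt ℝ w y) (dΩ : extDeriv Ω y = 0)
    (du : extDeriv (fun z => curryLeft (Ω z) (u z)) y = 0)
    (dv : extDeriv (fun z => curryLeft (Ω z) (v z)) y = 0)
    (dw : extDeriv (fun z => curryLeft (Ω z) (w z)) y = 0) (a : E) :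
    fderiv ℝ (fun z => Ω z ![u z, v z, w z]) y a =
      -Ω y ![u y, VectorField.lieBracket ℝ v w y, a]
        + Ω y ![v y, VectorField.lieBracket ℝ u w y, a]
        - Ω y ![w y, VectorField.lieBracket ℝ u v y, a] := by
  rw [fderiv_eval_three hΩ hu hv hw]
  have h1 := lieDeriv_eq_zero hΩ hu dΩ du (v y) (w y) a
  have h2 := lieDeriv_eq_zero hΩ hv dΩ dv (u y) (w y) a
  have h3 := lieDeriv_eq_zero hΩ hw dΩ dw (u y) (v y) a
  have h4 := extDeriv_apply_four Ω y (u y) (v y) (w y) a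
  rw [dΩ] at h4
  change (0 : ℝ) = _ at h4
  rw [map_swap_left _ (VectorField.lieBracket ℝ v w y),
    map_swap_left _ (VectorField.lieBracket ℝ u w y),
    map_swap_left _ (VectorField.lieBracket ℝ u v y)]
  simp only [VectorField.lieBracket, map_sub_left]
  have s1 := map_swap_left (Ω y) (v y) (fderiv ℝ u y (w y)) a
  have s2 := map_swap_left (Ω y) (u y) (fderiv ℝ v y (w y)) a
  have s3 := map_swap_left (Ω y) (u y) (fderiv ℝ w y (v y)) a
  have s4 := map_swap_left (Ω y) (v y) (fderiv ℝ u y a) (w y)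
  have s5 := map_swap_right (Ω y) (v y) (w y) (fderiv ℝ u y a)
  have s6 := map_swap_right (Ω y) (u y) (w y) (fderiv ℝ v y a)
  have s7 := map_swap_right (Ω y) (u y) (v y) (fderiv ℝ w y a)
  linarith

end VectorSpace

/-! ### Linear algebra -/

section Linear

/-- Pointwise solvability of `A v = B u` yields a solution linear in `u`: vector spaces are
projective. -/
theorem exists_linearMap_comp_eq {U V W : Type*} [AddCommGroup U] [Module ℝ U] [AddCommGroup V]
    [Module ℝ V] [AddCommGroup W] [Module ℝ W] (A : V →ₗ[ℝ] W) (B : U →ₗ[ℝ] W)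
    (h : ∀ u, ∃ v, A v = B u) : ∃ C : U →ₗ[ℝ] V, ∀ u, A (C u) = B u := by
  obtain ⟨C, hC⟩ := Module.projective_lifting_property A.rangeRestrict (B.codRestrict A.range h)
    A.surjective_rangeRestrict
  exact ⟨C, fun u => congrArg Subtype.val (LinearMap.congr_fun hC u)⟩

/-- An alternating bilinear map as an alternating map on `Fin 2`. -/
def alternatingOfBilin {U V : Type*} [AddCommGroup U] [Module ℝ U] [AddCommGroup V] [Module ℝ V]
    (F : U →ₗ[ℝ] U →ₗ[ℝ] V) (hF : ∀ x, F x x = 0) : U [⋀^Fin 2]→ₗ[ℝ] V where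
  toFun w := F (w 0) (w 1)
  map_update_add' w i x y := by fin_cases i <;> simp
  map_update_smul' w i c x := by fin_cases i <;> simp
  map_eq_zero_of_eq' w i j hij hne := by
    have h01 : w 0 = w 1 := by fin_cases i <;> fin_cases j <;> simp_all
    change F (w 0) (w 1) = 0
    rw [h01, hF]

end Linear

section Manifold

variable {E M : Type*} [NormedAddCommGroup E] [NormedSpace ℝ E]
  [TopologicalSpace M] [ChartedSpace E M] [IsManifold 𝓘(ℝ, E) ∞ M]

/-! ### Differential forms and vector fields in charts -/

omit [IsManifold 𝓘(ℝ, E) ∞ M] in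
theorem contDiffAt_comp_extChartAt_symm {G : Type*} [NormedAddCommGroup G] [NormedSpace ℝ G]
    {f : M → G} {q : M} (hf : ContMDiffAt 𝓘(ℝ, E) 𝓘(ℝ, G) ∞ f q) :
    ContDiffAt ℝ ∞ (fun y => f ((extChartAt 𝓘(ℝ, E) q).symm y)) (extChartAt 𝓘(ℝ, E) q q) := by
  have h := (contMDiffAt_iff.1 hf).2
  rw [modelWithCornersSelf_coe, Set.range_id, contDiffWithinAt_univ] at h
  exact h

theorem symmL_trivializationAt_eq_mfderiv {q : M} {y : E}
    (hy : y ∈ (extChartAt 𝓘(ℝ, E) q).target) :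
    (trivializationAt E (TangentSpace 𝓘(ℝ, E)) q).symmL ℝ ((extChartAt 𝓘(ℝ, E) q).symm y) =
      mfderiv 𝓘(ℝ, E) 𝓘(ℝ, E) (extChartAt 𝓘(ℝ, E) q).symm y := by
  have h := (extChartAt 𝓘(ℝ, E) q).map_target hy
  rw [extChartAt_source] at h
  rw [TangentBundle.symmL_trivializationAt h, (extChartAt 𝓘(ℝ, E) q).right_inv hy]
  rw [modelWithCornersSelf_coe, Set.range_id, mfderivWithin_univ]

/-- The coordinates at `x` of an alternating form on `T_x M` in the trivialization at `q`. -/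
def formCoord {k : ℕ} (q x : M) (η : TangentSpace 𝓘(ℝ, E) x [⋀^Fin k]→L[ℝ] ℝ) :
    E [⋀^Fin k]→L[ℝ] ℝ :=
  ContinuousAlternatingMap.compContinuousLinearMap η
    ((trivializationAt E (TangentSpace 𝓘(ℝ, E)) q).symmL ℝ x)

/-- A section of the bundle of alternating forms is smooth at `q` if and only if its coordinates in
the trivialization of the tangent bundle at `q` are. -/
theorem contMDiffAt_form_iff {k : ℕ}
    (α : ∀ x : M, TangentSpace 𝓘(ℝ, E) x [⋀^Fin k]→L[ℝ] Bundle.Trivial M ℝ x) (q : M) :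
    ContMDiffAt 𝓘(ℝ, E) (𝓘(ℝ, E).prod 𝓘(ℝ, E [⋀^Fin k]→L[ℝ] ℝ)) ∞
        (fun x => TotalSpace.mk' (E [⋀^Fin k]→L[ℝ] ℝ) x (α x)) q ↔
      ContMDiffAt 𝓘(ℝ, E) 𝓘(ℝ, E [⋀^Fin k]→L[ℝ] ℝ) ∞ (fun x => formCoord q x (α x)) q := by
  rw [contMDiffAt_section]
  refine iff_of_eq (congrArg (fun c => ContMDiffAt 𝓘(ℝ, E) 𝓘(ℝ, E [⋀^Fin k]→L[ℝ] ℝ) ∞ c q) ?_)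
  funext x
  rw [FiberBundle.trivializationAt_continuousAlternatingMap_apply]
  ext v
  simp [ContinuousAlternatingMap.inCoordinates, formCoord]

theorem formCoord_symm_eq_chartForm {k : ℕ} (α : DForm E M k) {q : M} {y : E}
    (hy : y ∈ (extChartAt 𝓘(ℝ, E) q).target) :
    formCoord q ((extChartAt 𝓘(ℝ, E) q).symm y) (α ((extChartAt 𝓘(ℝ, E) q).symm y)) =
      chartForm α q y := by
  rw [formCoord, symmL_trivializationAt_eq_mfderiv hy]
  rfl

theorem contDiffAt_chartForm {k : ℕ} (α : DForm E M k) (q : M) :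
    ContDiffAt ℝ ∞ (chartForm α q) (extChartAt 𝓘(ℝ, E) q q) := by
  have h := contDiffAt_comp_extChartAt_symm ((contMDiffAt_form_iff _ q).1 (α.contMDiff q))
  refine h.congr_of_eventuallyEq ?_
  filter_upwards [extChartAt_target_mem_nhds (I := 𝓘(ℝ, E)) q] with y hy
  exact (formCoord_symm_eq_chartForm α hy).symm

theorem differentiableAt_chartForm {k : ℕ} (α : DForm E M k) (q : M) :
    DifferentiableAt ℝ (chartForm α q) (extChartAt 𝓘(ℝ, E) q q) :=
  (contDiffAt_chartForm α q).differentiableAt (by simp)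

/-- The coordinates of a vector field `v` in the trivialization at `q`. -/
def vfCoord (v : VField E M) (q x : M) : E :=
  (trivializationAt E (TangentSpace 𝓘(ℝ, E)) q).continuousLinearMapAt ℝ x (v x)

/-- The vector field `v` in the chart at `q`, i.e. its push-forward under that chart: the
trivialization of the tangent bundle at `q` is the derivative of the chart. -/
def chartVF (v : VField E M) (q : M) (y : E) : E :=
  vfCoord v q ((extChartAt 𝓘(ℝ, E) q).symm y)

theorem contMDiffAt_vfCoord (v : VField E M) (q : M) :
    ContMDiffAt 𝓘(ℝ, E) 𝓘(ℝ, E) ∞ (vfCoord v q) q := by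
  have h := (contMDiffAt_section (F := E) q).1 (v.contMDiff q)
  refine h.congr_of_eventuallyEq ?_
  filter_upwards [(trivializationAt E (TangentSpace 𝓘(ℝ, E)) q).open_baseSet.mem_nhds
    (mem_baseSet_trivializationAt E (TangentSpace 𝓘(ℝ, E)) q)] with x hx
  rw [vfCoord, Trivialization.continuousLinearMapAt_apply, Trivialization.linearMapAt_apply,
    if_pos hx]

theorem differentiableAt_chartVF (v : VField E M) (q : M) :
    DifferentiableAt ℝ (chartVF v q) (extChartAt 𝓘(ℝ, E) q q) :=
  (contDiffAt_comp_extChartAt_symm (contMDiffAt_vfCoord v q)).differentiableAt (by simp)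

theorem symmL_vfCoord (v : VField E M) {q x : M} (hx : x ∈ (chartAt E q).source) :
    (trivializationAt E (TangentSpace 𝓘(ℝ, E)) q).symmL ℝ x (vfCoord v q x) = v x := by
  apply Trivialization.symmL_continuousLinearMapAt
  simpa using hx

theorem formCoord_curryLeft {k : ℕ} (v : VField E M) {q x : M} (hx : x ∈ (chartAt E q).source)
    (η : TangentSpace 𝓘(ℝ, E) x [⋀^Fin (k + 1)]→L[ℝ] ℝ) :
    formCoord q x (ContinuousAlternatingMap.curryLeft (E := E) (F := ℝ) η (v x)) =
      ContinuousAlternatingMap.curryLeft (formCoord q x η) (vfCoord v q x) := by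
  rw [← symmL_vfCoord v hx]
  exact (ContinuousAlternatingMap.curryLeft_compContinuousLinearMap (E := E) (F := E) η
    ((trivializationAt E (TangentSpace 𝓘(ℝ, E)) q).symmL ℝ x) (vfCoord v q x)).symm

/-- The contraction `i_v α`, as a smooth form. -/
def iota {k : ℕ} (v : VField E M) (α : DForm E M (k + 1)) : DForm E M k where
  toFun x := ContinuousAlternatingMap.curryLeft (E := E) (F := ℝ) (α x) (v x)
  contMDiff_toFun q := by
    refine (contMDiffAt_form_iff _ q).2 ?_
    have h1 := (contMDiffAt_form_iff _ q).1 (α.contMDiff q)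
    have hL : ContDiff ℝ ∞ (fun η : E [⋀^Fin (k + 1)]→L[ℝ] ℝ => η.curryLeft) := by
      have h := LinearIsometry.contDiff (𝕜 := ℝ) (n := ∞) (E := E [⋀^Fin (k + 1)]→L[ℝ] ℝ)
        (F := E →L[ℝ] E [⋀^Fin k]→L[ℝ] ℝ)
        (ContinuousAlternatingMap.curryLeftLI (𝕜 := ℝ) (E := E) (F := ℝ) (n := k))
      exact h
    have h2 : ContMDiffAt 𝓘(ℝ, E) 𝓘(ℝ, E →L[ℝ] E [⋀^Fin k]→L[ℝ] ℝ) ∞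
        (fun x => ContinuousAlternatingMap.curryLeft (formCoord q x (α x))) q :=
      ContMDiffAt.comp (g := fun η : E [⋀^Fin (k + 1)]→L[ℝ] ℝ => η.curryLeft) q
        hL.contMDiff.contMDiffAt h1
    refine (h2.clm_apply (contMDiffAt_vfCoord v q)).congr_of_eventuallyEq ?_
    filter_upwards [chart_source_mem_nhds E q] with x hx
    exact formCoord_curryLeft v hx (α x)

theorem chartForm_iota {k : ℕ} (v : VField E M) (α : DForm E M (k + 1)) {q : M} {y : E}
    (hy : y ∈ (extChartAt 𝓘(ℝ, E) q).target) :
    chartForm (iota v α) q y =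
      ContinuousAlternatingMap.curryLeft (chartForm α q y) (chartVF v q y) := by
  have h := (extChartAt 𝓘(ℝ, E) q).map_target hy
  rw [extChartAt_source] at h
  rw [← formCoord_symm_eq_chartForm _ hy, ← formCoord_symm_eq_chartForm _ hy]
  exact formCoord_curryLeft v h _

/-- The derivative of the chart at `q` is the identity of `T_q M` at `q` itself, so it disappears from
the definition of `dR`. -/
theorem dR_eq_extDeriv {k : ℕ} (α : DForm E M k) (q : M) :
    dR α q = extDeriv (chartForm α q) (extChartAt 𝓘(ℝ, E) q q) := by
  rw [dR, mfderiv_extChartAt_self]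
  rfl

theorem symmL_trivializationAt_self (q : M) (w : TangentSpace 𝓘(ℝ, E) q) :
    (trivializationAt E (TangentSpace 𝓘(ℝ, E)) q).symmL ℝ q w = w := by
  have h := Trivialization.symmL_continuousLinearMapAt (R := ℝ)
    (trivializationAt E (TangentSpace 𝓘(ℝ, E)) q)
    (mem_baseSet_trivializationAt E (TangentSpace 𝓘(ℝ, E)) q) w
  rw [TangentBundle.continuousLinearMapAt_trivializationAt (mem_chart_source E q),
    mfderiv_extChartAt_self] at h
  exact h

theorem chartForm_self {k : ℕ} (α : DForm E M k) (q : M) :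
    chartForm α q (extChartAt 𝓘(ℝ, E) q q) = α q := by
  have e : formCoord q ((extChartAt 𝓘(ℝ, E) q).symm (extChartAt 𝓘(ℝ, E) q q))
      (α ((extChartAt 𝓘(ℝ, E) q).symm (extChartAt 𝓘(ℝ, E) q q))) = formCoord q q (α q) :=
    congrArg (fun x => formCoord q x (α x)) (extChartAt_to_inv q)
  rw [← formCoord_symm_eq_chartForm α (mem_extChartAt_target q), e]
  ext w
  exact congrArg (α q) (funext fun i => symmL_trivializationAt_self q (w i))

theorem chartVF_self (v : VField E M) (q : M) : chartVF v q (extChartAt 𝓘(ℝ, E) q q) = v q := by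
  have e : chartVF v q (extChartAt 𝓘(ℝ, E) q q) = vfCoord v q q :=
    congrArg (vfCoord v q) (extChartAt_to_inv q)
  rw [e, vfCoord, TangentBundle.continuousLinearMapAt_trivializationAt (mem_chart_source E q),
    mfderiv_extChartAt_self]
  rfl

theorem mpullbackWithin_eq_chartVF (v : VField E M) {q : M} {y : E}
    (hy : y ∈ (extChartAt 𝓘(ℝ, E) q).target) :
    VectorField.mpullbackWithin 𝓘(ℝ, E) 𝓘(ℝ, E) (extChartAt 𝓘(ℝ, E) q).symm (fun m => v m)
      (Set.range 𝓘(ℝ, E)) y = chartVF v q y := by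
  have h := (extChartAt 𝓘(ℝ, E) q).map_target hy
  rw [extChartAt_source] at h
  rw [VectorField.mpullbackWithin_apply, chartVF, vfCoord,
    TangentBundle.continuousLinearMapAt_trivializationAt h,
    ContinuousLinearMap.inverse_eq (mfderivWithin_extChartAt_symm_comp_mfderiv_extChartAt hy)
      (mfderiv_extChartAt_comp_mfderivWithin_extChartAt_symm hy)]
  rfl

theorem mlieBracket_eq_lieBracket (v w : VField E M) (q : M) :
    VectorField.mlieBracket 𝓘(ℝ, E) (fun m => v m) (fun m => w m) q =
      VectorField.lieBracket ℝ (chartVF v q) (chartVF w q) (extChartAt 𝓘(ℝ, E) q q) := by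
  have ev : ∀ u : VField E M, VectorField.mpullbackWithin 𝓘(ℝ, E) 𝓘(ℝ, E)
      (extChartAt 𝓘(ℝ, E) q).symm (fun m => u m) (Set.range 𝓘(ℝ, E))
        =ᶠ[𝓝 (extChartAt 𝓘(ℝ, E) q q)] chartVF u q := fun u => by
    filter_upwards [extChartAt_target_mem_nhds (I := 𝓘(ℝ, E)) q] with y hy
    exact mpullbackWithin_eq_chartVF u hy
  have hid : (mfderiv 𝓘(ℝ, E) 𝓘(ℝ, E) (extChartAt 𝓘(ℝ, E) q) q).inverse =
      ContinuousLinearMap.id ℝ E := by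
    rw [mfderiv_extChartAt_self]
    exact ContinuousLinearMap.inverse_id
  rw [← VectorField.mlieBracketWithin_univ, VectorField.mlieBracketWithin_apply]
  have hb : ∀ V W : E → E, VectorField.lieBracketWithin ℝ V W
      ((extChartAt 𝓘(ℝ, E) q).symm ⁻¹' Set.univ ∩ Set.range 𝓘(ℝ, E)) =
        VectorField.lieBracket ℝ V W := fun V W => by
    rw [Set.preimage_univ, modelWithCornersSelf_coe, Set.range_id, Set.inter_univ,
      VectorField.lieBracketWithin_univ]
  exact (DFunLike.congr_fun hid _).trans ((congrFun (hb _ _) _).trans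
    ((ev v).lieBracket_vectorField_eq (ev w)))

/-! ### The exterior differential in charts -/

theorem minSmoothness_le_infty : minSmoothness ℝ 2 ≤ (∞ : WithTop ℕ∞) := by
  rw [minSmoothness_of_isRCLikeNormedField]
  exact ENat.LEInfty.out

/-- The chart representations at `q` and at a nearby point differ by the transition map. -/
theorem chartForm_eq_pullback {k : ℕ} (α : DForm E M k) (q q' : M) {z : E}
    (hz : z ∈ (extChartAt 𝓘(ℝ, E) q).target)
    (hz' : (extChartAt 𝓘(ℝ, E) q).symm z ∈ (extChartAt 𝓘(ℝ, E) q').source) :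
    chartForm α q z =
      (chartForm α q' (extChartAt 𝓘(ℝ, E) q' ((extChartAt 𝓘(ℝ, E) q).symm z))).compContinuousLinearMap
        (fderiv ℝ (extChartAt 𝓘(ℝ, E) q' ∘ (extChartAt 𝓘(ℝ, E) q).symm) z) := by
  have hx := (extChartAt 𝓘(ℝ, E) q).map_target hz
  have hx' := hz'
  have e := congrArg (fun x => formCoord q' x (α x)) ((extChartAt 𝓘(ℝ, E) q').left_inv hz')
  rw [← formCoord_symm_eq_chartForm α hz,
    ← formCoord_symm_eq_chartForm α ((extChartAt 𝓘(ℝ, E) q').map_source hz')]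
  rw [extChartAt_source] at hx hx'
  have d : ∀ w, fderiv ℝ (extChartAt 𝓘(ℝ, E) q' ∘ (extChartAt 𝓘(ℝ, E) q).symm) z w =
      (trivializationAt E (TangentSpace 𝓘(ℝ, E)) q').continuousLinearMapAt ℝ
        ((extChartAt 𝓘(ℝ, E) q).symm z)
        ((trivializationAt E (TangentSpace 𝓘(ℝ, E)) q).symmL ℝ
          ((extChartAt 𝓘(ℝ, E) q).symm z) w) := by
    intro w
    rw [TangentBundle.continuousLinearMapAt_trivializationAt hx',
      symmL_trivializationAt_eq_mfderiv hz, ← mfderiv_eq_fderiv, mfderiv_comp (I' := 𝓘(ℝ, E)) z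
        (mdifferentiableAt_extChartAt hx')]
    · rfl
    · have := mdifferentiableWithinAt_extChartAt_symm hz
      rwa [modelWithCornersSelf_coe, Set.range_id, mdifferentiableWithinAt_univ] at this
  ext w
  refine Eq.trans ?_ (congrArg (fun η : E [⋀^Fin k]→L[ℝ] ℝ => η fun i =>
    fderiv ℝ (extChartAt 𝓘(ℝ, E) q' ∘ (extChartAt 𝓘(ℝ, E) q).symm) z (w i)) e).symm
  refine congrArg (α ((extChartAt 𝓘(ℝ, E) q).symm z)) (funext fun i => ?_)
  change _ = (trivializationAt E (TangentSpace 𝓘(ℝ, E)) q').symmL ℝ _ (fderiv ℝ _ z (w i))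
  rw [d, Trivialization.symmL_continuousLinearMapAt]
  · rfl
  · simpa using hx'

/-- The differential computed in one chart agrees with the intrinsic one: if `β = dα` pointwise,
then the chart representation of `β` is the exterior derivative of that of `α`. -/
theorem chartForm_eq_extDeriv {k : ℕ} {α : DForm E M k} {β : DForm E M (k + 1)}
    (h : ∀ q, dR α q = β q) {q : M} {y : E} (hy : y ∈ (extChartAt 𝓘(ℝ, E) q).target) :
    chartForm β q y = extDeriv (chartForm α q) y := by
  set q' := (extChartAt 𝓘(ℝ, E) q).symm y with hq'
  set f := extChartAt 𝓘(ℝ, E) q' ∘ (extChartAt 𝓘(ℝ, E) q).symm with hf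
  have hsrc : q' ∈ (extChartAt 𝓘(ℝ, E) q').source := mem_extChartAt_source q'
  have ev : chartForm α q =ᶠ[𝓝 y]
      fun z => (chartForm α q' (f z)).compContinuousLinearMap (fderiv ℝ f z) := by
    have h1 := (isOpen_extChartAt_target (I := 𝓘(ℝ, E)) q).mem_nhds hy
    have h2 := (continuousAt_extChartAt_symm'' (I := 𝓘(ℝ, E)) hy).preimage_mem_nhds
      ((isOpen_extChartAt_source (I := 𝓘(ℝ, E)) q').mem_nhds hsrc)
    filter_upwards [h1, h2] with z hz hz'
    exact chartForm_eq_pullback α q q' hz hz'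
  have hfc : ContDiffAt ℝ ∞ f y := by
    have := contDiffWithinAt_ext_coord_change (I := 𝓘(ℝ, E)) (n := ∞) q' q (y := y)
      (by rw [PartialEquiv.trans_source]; exact ⟨hy, hsrc⟩)
    rwa [modelWithCornersSelf_coe, Set.range_id, contDiffWithinAt_univ] at this
  rw [ev.extDeriv_eq, extDeriv_pullback (f := f) (differentiableAt_chartForm α q') hfc minSmoothness_le_infty,
    chartForm_eq_pullback β q q' hy hsrc]
  congr 1
  exact (chartForm_self β q').trans ((h q').symm.trans (dR_eq_extDeriv α q'))

/-- `d ∘ d = 0`. -/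
theorem dR_eq_zero_of_exact {k : ℕ} {α : DForm E M k} {β : DForm E M (k + 1)}
    (h : ∀ q, dR α q = β q) (q : M) : dR β q = 0 := by
  have ev : chartForm β q =ᶠ[𝓝 (extChartAt 𝓘(ℝ, E) q q)] extDeriv (chartForm α q) := by
    filter_upwards [extChartAt_target_mem_nhds (I := 𝓘(ℝ, E)) q] with y hy
    exact chartForm_eq_extDeriv h hy
  rw [dR_eq_extDeriv, ev.extDeriv_eq]
  exact extDeriv_extDeriv_apply (contDiffAt_chartForm α q) minSmoothness_le_infty

/-! ### Linearity of the differential -/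

theorem dR_add {k : ℕ} (α β : DForm E M k) (q : M) : dR (α + β) q = dR α q + dR β q := by
  simp only [dR_eq_extDeriv]
  exact extDeriv_add (differentiableAt_chartForm α q) (differentiableAt_chartForm β q)

theorem dR_smul {k : ℕ} (c : ℝ) (α : DForm E M k) (q : M) : dR (c • α) q = c • dR α q := by
  simp only [dR_eq_extDeriv]
  exact extDeriv_smul c (chartForm α q)

variable (E M) in
/-- The de Rham differential as a linear map into families of alternating forms. -/
def dRLin (k : ℕ) : DForm E M k →ₗ[ℝ] ∀ q : M, TangentSpace 𝓘(ℝ, E) q [⋀^Fin (k + 1)]→L[ℝ] ℝ where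
  toFun α q := dR α q
  map_add' α β := funext (dR_add α β)
  map_smul' c α := funext (dR_smul c α)

theorem dR_neg {k : ℕ} (α : DForm E M k) (q : M) : dR (-α) q = -dR α q :=
  congrFun (map_neg (dRLin E M k) α) q

theorem dR_sub {k : ℕ} (α β : DForm E M k) (q : M) : dR (α - β) q = dR α q - dR β q :=
  congrFun (map_sub (dRLin E M k) α β) q

/-! ### Smooth functions -/

omit [IsManifold 𝓘(ℝ, E) ∞ M] in
theorem differentiableAt_comp_symm (f : SmoothFun E M) (q : M) :
    DifferentiableAt ℝ (fun y => f ((extChartAt 𝓘(ℝ, E) q).symm y)) (extChartAt 𝓘(ℝ, E) q q) :=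
  (contDiffAt_comp_extChartAt_symm f.contMDiff.contMDiffAt).differentiableAt (by simp)

omit [IsManifold 𝓘(ℝ, E) ∞ M] in
theorem dFun_apply (f : SmoothFun E M) (q : M) (w : Fin 1 → E) :
    dFun f q w = fderiv ℝ (fun y => f ((extChartAt 𝓘(ℝ, E) q).symm y))
      (extChartAt 𝓘(ℝ, E) q q) (w 0) := by
  have h1 : fderivWithin ℝ (fun y => f ((extChartAt 𝓘(ℝ, E) q).symm y)) (Set.range 𝓘(ℝ, E))
      (extChartAt 𝓘(ℝ, E) q q) = fderiv ℝ (fun y => f ((extChartAt 𝓘(ℝ, E) q).symm y))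
        (extChartAt 𝓘(ℝ, E) q q) := by
    rw [modelWithCornersSelf_coe, Set.range_id, fderivWithin_univ]
  have h2 : mfderiv 𝓘(ℝ, E) 𝓘(ℝ, ℝ) f q = fderiv ℝ (fun y => f ((extChartAt 𝓘(ℝ, E) q).symm y))
      (extChartAt 𝓘(ℝ, E) q q) :=
    (MDifferentiableAt.mfderiv (f.contMDiff.mdifferentiableAt (by simp))).trans h1
  exact DFunLike.congr_fun h2 (w 0)

omit [IsManifold 𝓘(ℝ, E) ∞ M] in
theorem dFun_add (f f' : SmoothFun E M) (q : M) : dFun (f + f') q = dFun f q + dFun f' q := by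
  refine ContinuousAlternatingMap.ext fun (w : Fin 1 → E) => ?_
  have h := DFunLike.congr_fun (fderiv_add (differentiableAt_comp_symm f q)
    (differentiableAt_comp_symm f' q)) (w 0)
  exact (dFun_apply _ q w).trans (h.trans
    (congrArg₂ (· + ·) (dFun_apply f q w) (dFun_apply f' q w)).symm)

omit [IsManifold 𝓘(ℝ, E) ∞ M] in
theorem dFun_smul (c : ℝ) (f : SmoothFun E M) (q : M) : dFun (c • f) q = c • dFun f q := by
  refine ContinuousAlternatingMap.ext fun (w : Fin 1 → E) => ?_
  have h := DFunLike.congr_fun (fderiv_const_smul (differentiableAt_comp_symm f q) c) (w 0)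
  exact (dFun_apply _ q w).trans (h.trans (congrArg (c • ·) (dFun_apply f q w)).symm)

variable (E M) in
/-- The differential of functions as a linear map into families of alternating forms. -/
def dFunLin : SmoothFun E M →ₗ[ℝ] ∀ q : M, TangentSpace 𝓘(ℝ, E) q [⋀^Fin 1]→L[ℝ] ℝ where
  toFun f q := dFun f q
  map_add' f f' := funext (dFun_add f f')
  map_smul' c f := funext (dFun_smul c f)

omit [IsManifold 𝓘(ℝ, E) ∞ M] in
theorem dFun_sub (f f' : SmoothFun E M) (q : M) : dFun (f - f') q = dFun f q - dFun f' q :=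
  congrFun (map_sub (dFunLin E M) f f') q

omit [IsManifold 𝓘(ℝ, E) ∞ M] in
theorem dFun_const (c : ℝ) (q : M) :
    dFun (ContMDiffMap.const c : SmoothFun E M) q = 0 := by
  refine ContinuousAlternatingMap.ext fun (w : Fin 1 → E) => (dFun_apply _ q w).trans ?_
  exact DFunLike.congr_fun (fderiv_const_apply c) (w 0)

/-- On a connected manifold a function with vanishing differential is constant. -/
theorem apply_eq_of_dFun_eq_zero [ConnectedSpace M] {f : SmoothFun E M}
    (h : ∀ q, dFun f q = 0) (x y : M) : f x = f y := by
  refine IsLocallyConstant.apply_eq_of_preconnectedSpace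
    ((IsLocallyConstant.iff_eventually_eq f).2 fun q => ?_) x y
  -- in a chart `f` has vanishing derivative on a ball, hence is constant there
  have hm : ∀ x, mfderiv 𝓘(ℝ, E) 𝓘(ℝ, ℝ) f x = 0 := fun x => by
    ext w
    exact DFunLike.congr_fun (h x) fun _ => w
  obtain ⟨r, hr, hball⟩ := Metric.mem_nhds_iff.1 (extChartAt_target_mem_nhds (I := 𝓘(ℝ, E)) q)
  have hd : ∀ z ∈ Metric.ball (extChartAt 𝓘(ℝ, E) q q) r,
      HasFDerivAt (f ∘ (extChartAt 𝓘(ℝ, E) q).symm) (0 : E →L[ℝ] ℝ) z := by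
    intro z hz
    have hs : MDifferentiableAt 𝓘(ℝ, E) 𝓘(ℝ, E) (extChartAt 𝓘(ℝ, E) q).symm z := by
      have := mdifferentiableWithinAt_extChartAt_symm (I := 𝓘(ℝ, E)) (hball hz)
      rwa [modelWithCornersSelf_coe, Set.range_id, mdifferentiableWithinAt_univ] at this
    have hf : MDifferentiableAt 𝓘(ℝ, E) 𝓘(ℝ, ℝ) f ((extChartAt 𝓘(ℝ, E) q).symm z) :=
      f.contMDiff.mdifferentiableAt (by simp)
    have hc := (hf.hasMFDerivAt.comp z hs.hasMFDerivAt).hasFDerivAt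
    rw [hm, ContinuousLinearMap.zero_comp] at hc
    exact hc
  have hconst : ∀ z ∈ Metric.ball (extChartAt 𝓘(ℝ, E) q q) r,
      f ((extChartAt 𝓘(ℝ, E) q).symm z) = f q := by
    intro z hz
    have := (convex_ball (extChartAt 𝓘(ℝ, E) q q) r).is_const_of_fderivWithin_eq_zero (𝕜 := ℝ)
      (f := f ∘ (extChartAt 𝓘(ℝ, E) q).symm)
      (fun z hz => (hd z hz).differentiableAt.differentiableWithinAt)
      (fun z hz => by
        rw [fderivWithin_of_isOpen Metric.isOpen_ball hz, (hd z hz).fderiv])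
      hz (Metric.mem_ball_self hr)
    simpa using this
  filter_upwards [(continuousAt_extChartAt (I := 𝓘(ℝ, E)) q).preimage_mem_nhds
    (Metric.ball_mem_nhds _ hr), extChartAt_source_mem_nhds (I := 𝓘(ℝ, E)) q] with z hz hz'
  have := hconst _ hz
  rwa [(extChartAt 𝓘(ℝ, E) q).left_inv hz'] at this

/-- On a connected manifold a function is determined by its differential and one value. -/
theorem smoothFun_ext_of_dFun [ConnectedSpace M] {f f' : SmoothFun E M} (p : M)
    (h : ∀ q, dFun f q = dFun f' q) (hp : f p = f' p) : f = f' := by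
  ext q
  have := apply_eq_of_dFun_eq_zero (f := f - f') (fun q => by rw [dFun_sub, h, sub_self]) q p
  have e : f q - f' q = f p - f' p := this
  linarith

/-- Normalized primitives of closed `1`-forms. -/
theorem exists_primitive (hM : FirstDeRhamVanishes E M) (p : M) {α : DForm E M 1}
    (h : ∀ q, dR α q = 0) : ∃ f : SmoothFun E M, (∀ q, dFun f q = α q) ∧ f p = 0 := by
  obtain ⟨f, hf⟩ := hM α h
  refine ⟨f - ContMDiffMap.const (f p), fun q => ?_, sub_self _⟩
  rw [dFun_sub, ← hf q, sub_eq_self]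
  exact dFun_const _ q

/-- A `0`-form, as a smooth function. -/
def zeroForm (α : DForm E M 0) : SmoothFun E M where
  val q := α q ![]
  property q := by
    have h := (contMDiffAt_form_iff _ q).1 (α.contMDiff q)
    have h2 := (ContinuousAlternatingMap.apply ℝ E ℝ (![] : Fin 0 → E)).contMDiff.contMDiffAt.comp q h
    refine h2.congr_of_eventuallyEq (Filter.Eventually.of_forall fun x => ?_)
    exact congrArg (α x) (Subsingleton.elim _ _)

theorem zeroForm_symm (α : DForm E M 0) (q : M) (y : E) :
    zeroForm α ((extChartAt 𝓘(ℝ, E) q).symm y) = chartForm α q y ![] := by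
  have h : ∀ a b : Fin 0 → TangentSpace 𝓘(ℝ, E) ((extChartAt 𝓘(ℝ, E) q).symm y),
      α ((extChartAt 𝓘(ℝ, E) q).symm y) a = α ((extChartAt 𝓘(ℝ, E) q).symm y) b :=
    fun a b => by rw [Subsingleton.elim a b]
  exact h _ _

/-- The function `α(v, w, u)`. -/
def contractFun (α : DForm E M 3) (v w u : VField E M) : SmoothFun E M :=
  zeroForm (iota u (iota w (iota v α)))

theorem contractFun_symm (α : DForm E M 3) (v w u : VField E M) {q : M} {y : E}
    (hy : y ∈ (extChartAt 𝓘(ℝ, E) q).target) :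
    contractFun α v w u ((extChartAt 𝓘(ℝ, E) q).symm y) =
      chartForm α q y ![chartVF v q y, chartVF w q y, chartVF u q y] := by
  rw [contractFun, zeroForm_symm, chartForm_iota u _ hy, chartForm_iota w _ hy,
    chartForm_iota v _ hy]
  rfl

theorem dFun_contractFun_apply (α : DForm E M 3) (v w u : VField E M) (q : M) (a : Fin 1 → E) :
    dFun (contractFun α v w u) q a =
      fderiv ℝ (fun y => chartForm α q y ![chartVF v q y, chartVF w q y, chartVF u q y])
        (extChartAt 𝓘(ℝ, E) q q) (a 0) := by
  have ev : (fun y => contractFun α v w u ((extChartAt 𝓘(ℝ, E) q).symm y))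
      =ᶠ[𝓝 (extChartAt 𝓘(ℝ, E) q q)]
        fun y => chartForm α q y ![chartVF v q y, chartVF w q y, chartVF u q y] := by
    filter_upwards [extChartAt_target_mem_nhds (I := 𝓘(ℝ, E)) q] with y hy
    exact contractFun_symm α v w u hy
  rw [dFun_apply, ev.fderiv_eq]

/-! ### Hamiltonian vector fields -/

/-- A Hamiltonian vector field preserves the form: `d (i_v ϖ) = 0`. -/
theorem IsHamiltonianVF.dR_iota {ϖ : DForm E M 3} {α : DForm E M 1} {v : VField E M}
    (h : IsHamiltonianVF ϖ α v) (q : M) : dR (iota v ϖ) q = 0 := by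
  have h1 : dR (-iota v ϖ) q = 0 := dR_eq_zero_of_exact (α := α) (fun q => h q) q
  rwa [dR_neg, neg_eq_zero] at h1

theorem IsTwoPlectic.hamVF_eq {ϖ : DForm E M 3} (hϖ : IsTwoPlectic ϖ) {α : DForm E M 1}
    {v : VField E M} (h : IsHamiltonianVF ϖ α v) : hamVF ϖ α = v := by
  have H : IsHamiltonian ϖ α := ⟨v, h⟩
  rw [hamVF, dif_pos H]
  ext q
  exact hϖ.nondegenerate q (neg_injective ((H.choose_spec q).symm.trans (h q)))

theorem extDeriv_curryLeft_chartVF {ϖ : DForm E M 3} {v : VField E M} {q : M}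
    (h : dR (iota v ϖ) q = 0) :
    extDeriv (fun y => ContinuousAlternatingMap.curryLeft (chartForm ϖ q y) (chartVF v q y))
      (extChartAt 𝓘(ℝ, E) q q) = 0 := by
  have ev : chartForm (iota v ϖ) q =ᶠ[𝓝 (extChartAt 𝓘(ℝ, E) q q)]
      fun y => ContinuousAlternatingMap.curryLeft (chartForm ϖ q y) (chartVF v q y) := by
    filter_upwards [extChartAt_target_mem_nhds (I := 𝓘(ℝ, E)) q] with y hy
    exact chartForm_iota v ϖ hy
  rw [← ev.extDeriv_eq, ← dR_eq_extDeriv]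
  exact h

theorem extDeriv_chartForm_eq_zero {k : ℕ} {α : DForm E M k} {q : M} (h : dR α q = 0) :
    extDeriv (chartForm α q) (extChartAt 𝓘(ℝ, E) q q) = 0 :=
  (dR_eq_extDeriv α q).symm.trans h

/-! ### Hamiltonian actions -/

variable {g : Type*} [LieRing g] [LieAlgebra ℝ g] {ϖ : DForm E M 3} {ρ : g →ₗ[ℝ] VField E M}

theorem IsHamiltonianAction.dR_iota (hρ : IsHamiltonianAction ϖ ρ) (x : g) (q : M) :
    dR (iota (ρ x) ϖ) q = 0 :=
  (hρ.hamiltonian x).choose_spec.dR_iota q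

theorem IsHamiltonianAction.lieBracket_eq (hρ : IsHamiltonianAction ϖ ρ) (x y : g) (q : M) :
    VectorField.lieBracket ℝ (chartVF (ρ x) q) (chartVF (ρ y) q) (extChartAt 𝓘(ℝ, E) q q) =
      ρ ⁅x, y⁆ q :=
  (mlieBracket_eq_lieBracket _ _ q).symm.trans (hρ.map_lie x y q).symm

/-- `d (i(v_x ∧ v_y) ϖ) = -i_{v_[x, y]} ϖ`. -/
theorem IsHamiltonianAction.dR_contract₂ (hρ : IsHamiltonianAction ϖ ρ) (hϖ : IsTwoPlectic ϖ)
    (x y : g) (q : M) : dR (iota (ρ y) (iota (ρ x) ϖ)) q = -contract ϖ (ρ ⁅x, y⁆) q := by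
  have ev : chartForm (iota (ρ y) (iota (ρ x) ϖ)) q =ᶠ[𝓝 (extChartAt 𝓘(ℝ, E) q q)]
      fun z => ContinuousAlternatingMap.curryLeft (ContinuousAlternatingMap.curryLeft
        (chartForm ϖ q z) (chartVF (ρ x) q z)) (chartVF (ρ y) q z) := by
    filter_upwards [extChartAt_target_mem_nhds (I := 𝓘(ℝ, E)) q] with z hz
    rw [chartForm_iota _ _ hz, chartForm_iota _ _ hz]
  rw [dR_eq_extDeriv, ev.extDeriv_eq]
  refine ContinuousAlternatingMap.ext fun (w : Fin 2 → E) => ?_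
  have hw : w = ![w 0, w 1] := by ext i; fin_cases i <;> rfl
  have key := extDeriv_contract_contract (differentiableAt_chartForm ϖ q)
    (differentiableAt_chartVF (ρ x) q) (differentiableAt_chartVF (ρ y) q)
    (extDeriv_chartForm_eq_zero (hϖ.closed q)) (extDeriv_curryLeft_chartVF (hρ.dR_iota x q))
    (extDeriv_curryLeft_chartVF (hρ.dR_iota y q)) (w 0) (w 1)
  rw [hρ.lieBracket_eq, chartForm_self, ← hw] at key
  exact key

/-- The differential of `ϖ(v_x, v_y, v_z)`. -/
theorem IsHamiltonianAction.dFun_contractFun (hρ : IsHamiltonianAction ϖ ρ)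
    (hϖ : IsTwoPlectic ϖ) (x y z : g) (q : M) :
    dFun (contractFun ϖ (ρ x) (ρ y) (ρ z)) q =
      -contract₂ ϖ (ρ x) (ρ ⁅y, z⁆) q + contract₂ ϖ (ρ y) (ρ ⁅x, z⁆) q
        - contract₂ ϖ (ρ z) (ρ ⁅x, y⁆) q := by
  refine ContinuousAlternatingMap.ext fun (w : Fin 1 → E) => ?_
  have hw : w = ![w 0] := by ext i; fin_cases i; rfl
  have key := fderiv_eval_three_of_closed (differentiableAt_chartForm ϖ q)
    (differentiableAt_chartVF (ρ x) q) (differentiableAt_chartVF (ρ y) q)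
    (differentiableAt_chartVF (ρ z) q)
    (extDeriv_chartForm_eq_zero (hϖ.closed q)) (extDeriv_curryLeft_chartVF (hρ.dR_iota x q))
    (extDeriv_curryLeft_chartVF (hρ.dR_iota y q)) (extDeriv_curryLeft_chartVF (hρ.dR_iota z q))
    (w 0)
  rw [hρ.lieBracket_eq, hρ.lieBracket_eq, hρ.lieBracket_eq, chartForm_self, chartVF_self,
    chartVF_self, chartVF_self] at key
  refine (dFun_contractFun_apply ϖ _ _ _ q w).trans (key.trans ?_)
  conv_rhs => rw [hw]
  rfl

/-- Invariance of `ϖ`: the derivative of `ϖ(v_y, v_z, v_u)` along `v_x`. -/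
theorem IsHamiltonianAction.dFun_contractFun_along (hρ : IsHamiltonianAction ϖ ρ)
    (hϖ : IsTwoPlectic ϖ) (x y z u : g) (q : M) :
    dFun (contractFun ϖ (ρ y) (ρ z) (ρ u)) q ![ρ x q] =
      contract₃ ϖ (ρ ⁅x, y⁆) (ρ z) (ρ u) q + contract₃ ϖ (ρ y) (ρ ⁅x, z⁆) (ρ u) q
        + contract₃ ϖ (ρ y) (ρ z) (ρ ⁅x, u⁆) q := by
  have key := fderiv_eval_three_along (differentiableAt_chartForm ϖ q)
    (differentiableAt_chartVF (ρ x) q) (differentiableAt_chartVF (ρ y) q)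
    (differentiableAt_chartVF (ρ z) q) (differentiableAt_chartVF (ρ u) q)
    (extDeriv_chartForm_eq_zero (hϖ.closed q)) (extDeriv_curryLeft_chartVF (hρ.dR_iota x q))
  rw [hρ.lieBracket_eq, hρ.lieBracket_eq, hρ.lieBracket_eq, chartForm_self, chartVF_self,
    chartVF_self, chartVF_self, chartVF_self] at key
  exact (dFun_contractFun_apply ϖ _ _ _ q ![ρ x q]).trans key

theorem omega3_apply (ϖ : DForm E M 3) (ρ : g →ₗ[ℝ] VField E M) (p : M) (x y z : g) :
    omega3 ϖ ρ p ![x, y, z] = contract₃ ϖ (ρ x) (ρ y) (ρ z) p :=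
  congrArg (ϖ p) (by ext i; fin_cases i <;> rfl)

/-- `ϖ_{3p}` is a Chevalley-Eilenberg cocycle. -/
theorem IsHamiltonianAction.omega3_cocycle (hρ : IsHamiltonianAction ϖ ρ)
    (hϖ : IsTwoPlectic ϖ) (p : M) (x y z u : g) :
    omega3 ϖ ρ p ![⁅x, y⁆, z, u] + omega3 ϖ ρ p ![y, ⁅x, z⁆, u] + omega3 ϖ ρ p ![y, z, ⁅x, u⁆]
      - omega3 ϖ ρ p ![x, ⁅y, z⁆, u] - omega3 ϖ ρ p ![x, z, ⁅y, u⁆]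
      + omega3 ϖ ρ p ![x, y, ⁅z, u⁆] = 0 := by
  -- both formulas for the derivative of `ϖ(v_y, v_z, v_u)` along `v_x` are compared
  have h1 := hρ.dFun_contractFun_along hϖ x y z u p
  have h2 := congrArg (fun η => η ![ρ x p]) (hρ.dFun_contractFun hϖ y z u p)
  have h3 : dFun (contractFun ϖ (ρ y) (ρ z) (ρ u)) p ![ρ x p] =
      -contract₃ ϖ (ρ y) (ρ ⁅z, u⁆) (ρ x) p + contract₃ ϖ (ρ z) (ρ ⁅y, u⁆) (ρ x) p
        - contract₃ ϖ (ρ u) (ρ ⁅y, z⁆) (ρ x) p := h2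
  have l : ∀ a b c : g, contract₃ ϖ (ρ b) (ρ a) (ρ c) p = -contract₃ ϖ (ρ a) (ρ b) (ρ c) p :=
    fun a b c => map_swap_left (E := E) (ϖ p) (ρ a p) (ρ b p) (ρ c p)
  have r : ∀ a b c : g, contract₃ ϖ (ρ a) (ρ c) (ρ b) p = -contract₃ ϖ (ρ a) (ρ b) (ρ c) p :=
    fun a b c => map_swap_right (E := E) (ϖ p) (ρ a p) (ρ b p) (ρ c p)
  simp only [omega3_apply]
  have s1 := r y x ⁅z, u⁆
  have s2 := l x y ⁅z, u⁆
  have s3 := r z x ⁅y, u⁆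
  have s4 := l x z ⁅y, u⁆
  have s5 := r u x ⁅y, z⁆
  have s6 := l x u ⁅y, z⁆
  have s7 := r x ⁅y, z⁆ u
  linarith

/-! ### The standard moment map -/

omit [LieAlgebra ℝ g] in
theorem lie_jacobi_cyclic (x y z : g) : ⁅x, ⁅y, z⁆⁆ - ⁅y, ⁅x, z⁆⁆ + ⁅z, ⁅x, y⁆⁆ = 0 := by
  rw [leibniz_lie x y z, ← lie_skew z ⁅x, y⁆]
  abel

theorem pointExt_isLie2Algebra (hρ : IsHamiltonianAction ϖ ρ) (hϖ : IsTwoPlectic ϖ) (p : M) :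
    (pointExt ϖ ρ p).IsLie2Algebra where
  br_self x := lie_self x
  δ_act _ _ := by simp [pointExt]
  act_δ _ _ := by simp [pointExt]
  δ_tri x y z := by
    change (0 : g) = ⁅x, ⁅y, z⁆⁆ + ⁅y, ⁅z, x⁆⁆ + ⁅z, ⁅x, y⁆⁆
    exact (lie_jacobi x y z).symm
  tri_δ x y a := by
    have h : (pointExt ϖ ρ p).tri ![x, y, 0] = 0 :=
      (pointExt ϖ ρ p).tri.map_coord_zero (i := 2) rfl
    simpa [pointExt] using h
  tri_cocycle x y z u := by
    have h := hρ.omega3_cocycle hϖ p x y z u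
    have e : ∀ w, (pointExt ϖ ρ p).tri w = -omega3 ϖ ρ p w := fun _ => rfl
    have b : ∀ a b, (pointExt ϖ ρ p).br a b = ⁅a, b⁆ := fun _ _ => rfl
    have c : ∀ a b, (pointExt ϖ ρ p).act a b = 0 := fun _ _ => rfl
    simp only [e, b, c]
    linarith

/-- Hamiltonian `1`-forms for the fields `v_x` can be chosen linearly in `x`. -/
theorem IsHamiltonianAction.exists_linear (hρ : IsHamiltonianAction ϖ ρ) :
    ∃ γ₁ : g →ₗ[ℝ] DForm E M 1, ∀ x, IsHamiltonianVF ϖ (γ₁ x) (ρ x) := by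
  let B : g →ₗ[ℝ] ∀ q : M, TangentSpace 𝓘(ℝ, E) q [⋀^Fin 2]→L[ℝ] ℝ :=
    { toFun := fun x q => -contract ϖ (ρ x) q
      map_add' := fun x y => by
        funext q
        have h := map_add (ContinuousAlternatingMap.curryLeft (E := E) (F := ℝ) (ϖ q))
          (ρ x q) (ρ y q)
        have h' : contract ϖ (ρ (x + y)) q = contract ϖ (ρ x) q + contract ϖ (ρ y) q := by
          rw [map_add]
          exact h
        change -contract ϖ (ρ (x + y)) q = -contract ϖ (ρ x) q + -contract ϖ (ρ y) q
        rw [h', neg_add]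
      map_smul' := fun c x => by
        funext q
        have h := map_smul (ContinuousAlternatingMap.curryLeft (E := E) (F := ℝ) (ϖ q))
          c (ρ x q)
        have h' : contract ϖ (ρ (c • x)) q = c • contract ϖ (ρ x) q := by
          rw [map_smul]
          exact h
        change -contract ϖ (ρ (c • x)) q = c • -contract ϖ (ρ x) q
        rw [h', smul_neg] }
  obtain ⟨C, hC⟩ := exists_linearMap_comp_eq (dRLin E M 1) B fun x =>
    (hρ.hamiltonian x).imp fun α hα => funext hα
  exact ⟨C, fun x q => congrFun (hC x) q⟩

/-- The `1`-form `γ₁[x, y] - i(v_x ∧ v_y) ϖ`. -/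
def bracketDefect (ϖ : DForm E M 3) (ρ : g →ₗ[ℝ] VField E M) (γ₁ : g →ₗ[ℝ] DForm E M 1)
    (x y : g) : DForm E M 1 :=
  γ₁ ⁅x, y⁆ - iota (ρ y) (iota (ρ x) ϖ)

theorem contract₂_swap (ϖ : DForm E M 3) (v w : VField E M) (q : M) :
    contract₂ ϖ v w q = -contract₂ ϖ w v q := by
  refine ContinuousAlternatingMap.ext fun (a : Fin 1 → E) => ?_
  have ha : a = ![a 0] := by ext i; fin_cases i; rfl
  rw [ha]
  exact map_swap_left (E := E) (ϖ q) (w q) (v q) (a 0)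

theorem contract₂_add_right (ϖ : DForm E M 3) (v w w' : VField E M) (q : M) :
    contract₂ ϖ v (w + w') q = contract₂ ϖ v w q + contract₂ ϖ v w' q :=
  map_add (ContinuousAlternatingMap.curryLeft (E := E) (F := ℝ) (contract ϖ v q)) (w q) (w' q)

theorem contract₂_smul_right (ϖ : DForm E M 3) (c : ℝ) (v w : VField E M) (q : M) :
    contract₂ ϖ v (c • w) q = c • contract₂ ϖ v w q :=
  map_smul (ContinuousAlternatingMap.curryLeft (E := E) (F := ℝ) (contract ϖ v q)) c (w q)

theorem contract₂_add_left (ϖ : DForm E M 3) (v v' w : VField E M) (q : M) :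
    contract₂ ϖ (v + v') w q = contract₂ ϖ v w q + contract₂ ϖ v' w q := by
  rw [contract₂_swap, contract₂_add_right, neg_add, ← contract₂_swap, ← contract₂_swap]

theorem contract₂_smul_left (ϖ : DForm E M 3) (c : ℝ) (v w : VField E M) (q : M) :
    contract₂ ϖ (c • v) w q = c • contract₂ ϖ v w q := by
  rw [contract₂_swap, contract₂_smul_right, contract₂_swap ϖ v w]
  exact (smul_neg c (contract₂ ϖ w v q)).symm

theorem contract₂_self (ϖ : DForm E M 3) (v : VField E M) (q : M) : contract₂ ϖ v v q = 0 :=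
  ContinuousAlternatingMap.curryLeft_same (E := E) (F := ℝ) (ϖ q) (v q)

theorem dR_bracketDefect (hρ : IsHamiltonianAction ϖ ρ) (hϖ : IsTwoPlectic ϖ)
    {γ₁ : g →ₗ[ℝ] DForm E M 1} (hγ₁ : ∀ x, IsHamiltonianVF ϖ (γ₁ x) (ρ x)) (x y : g) (q : M) :
    dR (bracketDefect ϖ ρ γ₁ x y) q = 0 := by
  rw [bracketDefect, dR_sub, hρ.dR_contract₂ hϖ, hγ₁, sub_self]

/-- The component `γ₂` of the standard moment map: the primitive of `γ₁[x, y] - i(v_x ∧ v_y) ϖ`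
vanishing at `p`, which depends bilinearly on `x` and `y` because it is unique. -/
theorem exists_gamma_two [ConnectedSpace M] (hρ : IsHamiltonianAction ϖ ρ) (hϖ : IsTwoPlectic ϖ)
    (hM : FirstDeRhamVanishes E M) (p : M) {γ₁ : g →ₗ[ℝ] DForm E M 1}
    (hγ₁ : ∀ x, IsHamiltonianVF ϖ (γ₁ x) (ρ x)) :
    ∃ γ₂ : g [⋀^Fin 2]→ₗ[ℝ] SmoothFun E M, ∀ x y,
      (∀ q, dFun (γ₂ ![x, y]) q = γ₁ ⁅x, y⁆ q - contract₂ ϖ (ρ x) (ρ y) q) ∧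
        γ₂ ![x, y] p = 0 := by
  choose G hG hGp using fun x y => exists_primitive hM p (dR_bracketDefect hρ hϖ hγ₁ x y)
  have hG' : ∀ x y q, dFun (G x y) q = γ₁ ⁅x, y⁆ q - contract₂ ϖ (ρ x) (ρ y) q := hG
  let F : g →ₗ[ℝ] g →ₗ[ℝ] SmoothFun E M := LinearMap.mk₂ ℝ G
    (fun x x' y => by
      refine smoothFun_ext_of_dFun p (fun q => ?_) ?_
      · rw [dFun_add, hG', hG', hG', add_lie, map_add, map_add, contract₂_add_left]
        exact add_sub_add_comm _ _ _ _
      · exact (hGp _ _).trans (by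
          change (0 : ℝ) = G x y p + G x' y p
          rw [hGp, hGp, add_zero]))
    (fun c x y => by
      refine smoothFun_ext_of_dFun p (fun q => ?_) ?_
      · rw [dFun_smul, hG', hG', smul_lie, map_smul, map_smul, contract₂_smul_left, smul_sub]
        rfl
      · exact (hGp _ _).trans (by
          change (0 : ℝ) = c * G x y p
          rw [hGp, mul_zero]))
    (fun x y y' => by
      refine smoothFun_ext_of_dFun p (fun q => ?_) ?_
      · rw [dFun_add, hG', hG', hG', lie_add, map_add, map_add, contract₂_add_right]
        exact add_sub_add_comm _ _ _ _
      · exact (hGp _ _).trans (by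
          change (0 : ℝ) = G x y p + G x y' p
          rw [hGp, hGp, add_zero]))
    (fun c x y => by
      refine smoothFun_ext_of_dFun p (fun q => ?_) ?_
      · rw [dFun_smul, hG', hG', lie_smul, map_smul, map_smul, contract₂_smul_right, smul_sub]
        rfl
      · exact (hGp _ _).trans (by
          change (0 : ℝ) = c * G x y p
          rw [hGp, mul_zero]))
  refine ⟨alternatingOfBilin F fun x => ?_, fun x y => ⟨hG' x y, hGp x y⟩⟩
  refine smoothFun_ext_of_dFun (f' := 0) p (fun q => ?_) (hGp x x)
  refine (hG' x x q).trans ?_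
  rw [lie_self, map_zero, contract₂_self, sub_zero]
  exact (congrFun (map_zero (dFunLin E M)) q).symm

theorem IsTwoPlectic.hamBr_eq (hϖ : IsTwoPlectic ϖ) {α β : DForm E M 1} {v w : VField E M}
    (hα : IsHamiltonianVF ϖ α v) (hβ : IsHamiltonianVF ϖ β w) (q : M) :
    hamBr ϖ α β q = contract₂ ϖ v w q := by
  rw [hamBr, hϖ.hamVF_eq hα, hϖ.hamVF_eq hβ]

theorem IsTwoPlectic.hamTri_eq (hϖ : IsTwoPlectic ϖ) {α β γ : DForm E M 1} {v w u : VField E M}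
    (hα : IsHamiltonianVF ϖ α v) (hβ : IsHamiltonianVF ϖ β w) (hγ : IsHamiltonianVF ϖ γ u) (q : M) :
    hamTri ϖ α β γ q = -contract₃ ϖ v w u q := by
  rw [hamTri, hϖ.hamVF_eq hα, hϖ.hamVF_eq hβ, hϖ.hamVF_eq hγ]

variable (E M) in
/-- The constant functions, as a linear map. -/
def constLin : ℝ →ₗ[ℝ] SmoothFun E M where
  toFun c := ContMDiffMap.const c
  map_add' _ _ := rfl
  map_smul' _ _ := rfl

variable (E) in
/-- Evaluation of functions at `p`. -/
def evalLin (p : M) : SmoothFun E M →ₗ[ℝ] ℝ where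
  toFun f := f p
  map_add' _ _ := rfl
  map_smul' _ _ := rfl

variable (E M) in
/-- The pointwise values of a form, as a linear map. -/
def valueLin (k : ℕ) : DForm E M k →ₗ[ℝ] ∀ q : M, TangentSpace 𝓘(ℝ, E) q [⋀^Fin k]→L[ℝ] ℝ where
  toFun α q := α q
  map_add' _ _ := rfl
  map_smul' _ _ := rfl

/-- Closed `1`-forms depending linearly on a parameter have primitives depending linearly on it. -/
theorem exists_linear_primitive (hM : FirstDeRhamVanishes E M) (β : g →ₗ[ℝ] DForm E M 1)
    (hβ : ∀ x q, dR (β x) q = 0) : ∃ α : g →ₗ[ℝ] SmoothFun E M, ∀ x q, dFun (α x) q = β x q := by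
  obtain ⟨α, hα⟩ := exists_linearMap_comp_eq (dFunLin E M) ((valueLin E M 1).comp β) fun x =>
    (hM (β x) (hβ x)).imp fun f hf => funext fun q => (hf q).symm
  exact ⟨α, fun x q => congrFun (hα x) q⟩

/-- The data `(γ₁, r ↦ r, γ₂)` form a moment map. The trinary identity holds at `p` by the choice
of the base point, and both sides have the same differential. -/
theorem isMomentMap_standard [ConnectedSpace M] (hρ : IsHamiltonianAction ϖ ρ)
    (hϖ : IsTwoPlectic ϖ) {p : M} {γ₁ : g →ₗ[ℝ] DForm E M 1}
    (hγ₁ : ∀ x, IsHamiltonianVF ϖ (γ₁ x) (ρ x)) {γ₂ : g [⋀^Fin 2]→ₗ[ℝ] SmoothFun E M}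
    (hd : ∀ x y q, dFun (γ₂ ![x, y]) q = γ₁ ⁅x, y⁆ q - contract₂ ϖ (ρ x) (ρ y) q)
    (hp : ∀ x y, γ₂ ![x, y] p = 0) :
    IsMomentMap ϖ ρ (pointExt ϖ ρ p) ⟨γ₁, constLin E M, γ₂⟩ where
  hamiltonian x := ⟨ρ x, hγ₁ x⟩
  map_δ a q := by
    refine (dFun_const a q).trans ?_
    change _ = γ₁ 0 q
    rw [map_zero]
    rfl
  map_br x y q := by
    rw [hϖ.hamBr_eq (hγ₁ x) (hγ₁ y)]
    exact hd x y q
  map_act a x := by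
    have h0 : γ₂ ![0, x] = 0 := γ₂.map_coord_zero (i := 0) rfl
    have h1 : constLin E M (-(0 : ℝ)) = 0 := by rw [neg_zero, map_zero]
    exact h0.trans h1.symm
  map_tri x y z q := by
    rw [hϖ.hamTri_eq (hγ₁ x) (hγ₁ y) (hγ₁ z), sub_neg_eq_add]
    have key : constLin E M (-omega3 ϖ ρ p ![x, y, z]) + contractFun ϖ (ρ x) (ρ y) (ρ z) =
        γ₂ ![x, ⁅y, z⁆] - γ₂ ![y, ⁅x, z⁆] + γ₂ ![z, ⁅x, y⁆] := by
      refine smoothFun_ext_of_dFun p (fun q => ?_) ?_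
      · have hJ : γ₁ ⁅x, ⁅y, z⁆⁆ q - γ₁ ⁅y, ⁅x, z⁆⁆ q + γ₁ ⁅z, ⁅x, y⁆⁆ q = 0 := by
          have h := congrArg (fun w => γ₁ w q) (lie_jacobi_cyclic x y z)
          simp only [map_add, map_sub, map_zero] at h
          exact h
        rw [dFun_add, dFun_add, dFun_sub, hd, hd, hd, hρ.dFun_contractFun hϖ]
        refine Eq.trans (congrArg₂ (· + ·) (dFun_const _ q) rfl) ?_
        rw [← hJ]
        abel
      · change -omega3 ϖ ρ p ![x, y, z] + contract₃ ϖ (ρ x) (ρ y) (ρ z) p =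
          γ₂ ![x, ⁅y, z⁆] p - γ₂ ![y, ⁅x, z⁆] p + γ₂ ![z, ⁅x, y⁆] p
        rw [omega3_apply, hp, hp, hp]
        ring
    exact DFunLike.congr_fun key q
  moment x q := (hγ₁ x q).symm

/-! ### Universality -/

/-- Every moment map `μ` for a minimal Lie 2-algebra `L` factors through the standard one up to
inner equivalence. -/
theorem exists_factorization [ConnectedSpace M] (hϖ : IsTwoPlectic ϖ)
    (hM : FirstDeRhamVanishes E M) {p : M} {γ₁ : g →ₗ[ℝ] DForm E M 1} {γ : Cochain2 E M g ℝ}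
    (hγ₁ : ∀ x, IsHamiltonianVF ϖ (γ₁ x) (ρ x)) (hγ : IsStandardMomentMap ϖ ρ p γ₁ γ)
    {h : Type*} [AddCommGroup h] [Module ℝ h] {L : Lie2Brackets g h} (hmin : L.IsMinimal)
    (hbr : ∀ x y : g, L.br x y = ⁅x, y⁆) {μ : Cochain2 E M g h} (hμ : IsMomentMap ϖ ρ L μ) :
    ∃ (f : Lie2Hom L (pointExt ϖ ρ p)) (φ : Cochain2 E M g h),
      (∀ x, f.f1g x = x) ∧ IsMomentMap ϖ ρ L φ ∧ IsComp φ γ f ∧ InnerEquivalent L μ φ := by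
  have hδ : ∀ a, L.δ a = 0 := fun a => by rw [hmin]; rfl
  have hμ₁ : ∀ x, IsHamiltonianVF ϖ (μ.m1g x) (ρ x) := fun x q => (hμ.moment x q).symm
  obtain ⟨α, hα⟩ := exists_linear_primitive hM (γ₁ - μ.m1g) fun x q => by
    rw [LinearMap.sub_apply, dR_sub, hγ₁, hμ₁, sub_self]
  replace hα : ∀ x q, dFun (α x) q = γ₁ x q - μ.m1g x q := hα
  let F : g →ₗ[ℝ] g →ₗ[ℝ] SmoothFun E M :=
    (LieModule.toEnd ℝ g g : g →ₗ[ℝ] Module.End ℝ g).compr₂ α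
  have hF : ∀ x, F x x = 0 := fun x => by
    change α ⁅x, x⁆ = 0
    rw [lie_self, map_zero]
  let φ₂ : g [⋀^Fin 2]→ₗ[ℝ] SmoothFun E M := μ.m2 + alternatingOfBilin F hF
  have hφ₂ : ∀ x y, φ₂ ![x, y] = μ.m2 ![x, y] + α ⁅x, y⁆ := fun x y => rfl
  have hJ : ∀ x y z, α ⁅x, ⁅y, z⁆⁆ - α ⁅y, ⁅x, z⁆⁆ + α ⁅z, ⁅x, y⁆⁆ = 0 := fun x y z => by
    rw [← map_sub, ← map_add, lie_jacobi_cyclic, map_zero]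
  -- minimality turns the identity for `[x, a]` into the vanishing of `μ₁` on `[g, h]`
  have hact : ∀ a x, μ.m1h (L.act x a) = 0 := fun a x => by
    have h1 := hμ.map_act a x
    rw [hδ, map_neg] at h1
    have h0 : μ.m2 ![0, x] = 0 := μ.m2.map_coord_zero (i := 0) rfl
    rw [h0] at h1
    exact neg_eq_zero.1 h1.symm
  -- `μ₁ a` has differential `μ₁ (δ a) = 0`
  have hconst : ∀ a q, μ.m1h a q = μ.m1h a p := fun a q =>
    apply_eq_of_dFun_eq_zero (fun q => by rw [hμ.map_δ, hδ, map_zero]; rfl) q p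
  have htri : ∀ x y z q, μ.m1h (L.tri ![x, y, z]) q + contract₃ ϖ (ρ x) (ρ y) (ρ z) q =
      φ₂ ![x, ⁅y, z⁆] q - φ₂ ![y, ⁅x, z⁆] q + φ₂ ![z, ⁅x, y⁆] q := fun x y z q => by
    have h1 := hμ.map_tri x y z q
    rw [hϖ.hamTri_eq (hμ₁ x) (hμ₁ y) (hμ₁ z), sub_neg_eq_add, hbr, hbr, hbr] at h1
    have h2 : α ⁅x, ⁅y, z⁆⁆ q - α ⁅y, ⁅x, z⁆⁆ q + α ⁅z, ⁅x, y⁆⁆ q = 0 :=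
      DFunLike.congr_fun (hJ x y z) q
    rw [h1, hφ₂, hφ₂, hφ₂]
    change _ = (μ.m2 _ q + α _ q) - (μ.m2 _ q + α _ q) + (μ.m2 _ q + α _ q)
    linarith
  have hdφ : ∀ x y q, dFun (φ₂ ![x, y]) q = γ₁ ⁅x, y⁆ q - contract₂ ϖ (ρ x) (ρ y) q :=
    fun x y q => by
      rw [hφ₂, dFun_add, hμ.map_br, hα, hbr, hϖ.hamBr_eq (hμ₁ x) (hμ₁ y)]
      abel
  let f : Lie2Hom L (pointExt ϖ ρ p) :=
    { f1g := LinearMap.id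
      f1h := (evalLin E p).comp μ.m1h
      f2 := (evalLin E p).compAlternatingMap φ₂
      map_δ := fun a => (hδ a).symm
      map_br := fun x y => by
        rw [LinearMap.id_apply, hbr]
        exact (sub_self _).symm
      map_act := fun a x => by
        have h0 : φ₂ ![0, x] = 0 := φ₂.map_coord_zero (i := 0) rfl
        rw [hδ, LinearMap.compAlternatingMap_apply, h0, LinearMap.comp_apply, map_neg, hact]
        simp [pointExt]
      map_tri := fun x y z => by
        have h1 := htri x y z p
        rw [← omega3_apply ϖ ρ p x y z] at h1
        rw [hbr, hbr, hbr]
        change μ.m1h (L.tri ![x, y, z]) p - -omega3 ϖ ρ p ![x, y, z] =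
          φ₂ ![x, ⁅y, z⁆] p - φ₂ ![y, ⁅x, z⁆] p + φ₂ ![z, ⁅x, y⁆] p + 0 - 0 + 0
        linarith }
  refine ⟨f, ⟨γ₁, μ.m1h, φ₂⟩, fun x => rfl, ?_, ?_, α, fun x q => ?_, fun a => ?_, fun x y => ?_⟩
  · exact
      { hamiltonian := fun x => ⟨ρ x, hγ₁ x⟩
        map_δ := fun a q => by
          rw [hμ.map_δ, hδ, map_zero, map_zero]
        map_br := fun x y q => by
          rw [hdφ, hbr, hϖ.hamBr_eq (hγ₁ x) (hγ₁ y)]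
        map_act := fun a x => by
          have h0 : φ₂ ![0, x] = 0 := φ₂.map_coord_zero (i := 0) rfl
          rw [hδ, map_neg, hact, neg_zero]
          exact h0
        map_tri := fun x y z q => by
          rw [hϖ.hamTri_eq (hγ₁ x) (hγ₁ y) (hγ₁ z), sub_neg_eq_add, hbr, hbr, hbr]
          exact htri x y z q
        moment := fun x q => (hγ₁ x q).symm }
  · refine ⟨fun x => by rw [hγ.m1g]; rfl, fun a => ?_, fun x y => ?_⟩
    · ext q
      exact (hconst a q).trans (hγ.m1h _ q).symm
    -- `φ₂(x, y)` and `f₂(x, y) + γ₂(x, y)` have the same differential and the same value at `p`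
    · refine smoothFun_ext_of_dFun p (fun q => ?_) ?_
      · have h1 : γ.m1h (f.f2 ![x, y]) = ContMDiffMap.const (φ₂ ![x, y] p) := by
          ext q
          exact hγ.m1h _ q
        rw [h1, dFun_add, dFun_const, zero_add]
        exact (hdφ x y q).trans (hγ.d_m2 x y q).symm
      · have h1 : γ.m1h (f.f2 ![x, y]) p = φ₂ ![x, y] p := hγ.m1h _ p
        have h2 : γ.m2 ![f.f1g x, f.f1g y] p = 0 := hγ.m2_base x y
        change φ₂ ![x, y] p = γ.m1h (f.f2 ![x, y]) p + γ.m2 ![f.f1g x, f.f1g y] p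
        rw [h1, h2, add_zero]
  · rw [hα, neg_sub]
  · rw [hδ, map_zero, neg_zero, sub_self]
  · rw [hbr]
    change μ.m2 ![x, y] - φ₂ ![x, y] = _
    rw [hφ₂, sub_add_cancel_left]

end Manifold

end

end TwoPlectic

theorem mainTheorem5
    {E M g : Type*} [NormedAddCommGroup E] [NormedSpace ℝ E] [FiniteDimensional ℝ E]
    [TopologicalSpace M] [ChartedSpace E M] [IsManifold 𝓘(ℝ, E) ∞ M]
    [T2Space M] [SecondCountableTopology M] [ConnectedSpace M]
    [LieRing g] [LieAlgebra ℝ g] [FiniteDimensional ℝ g]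
    (ϖ : TwoPlectic.DForm E M 3) (hϖ : TwoPlectic.IsTwoPlectic ϖ)
    (ρ : g →ₗ[ℝ] TwoPlectic.VField E M) (hρ : TwoPlectic.IsHamiltonianAction ϖ ρ)
    (p : M) (hM : TwoPlectic.FirstDeRhamVanishes E M) :
    (TwoPlectic.pointExt ϖ ρ p).IsLie2Algebra ∧
    (∃ γ₁ : g →ₗ[ℝ] TwoPlectic.DForm E M 1,
      ∀ x, TwoPlectic.IsHamiltonianVF ϖ (γ₁ x) (ρ x)) ∧
    ∀ γ₁ : g →ₗ[ℝ] TwoPlectic.DForm E M 1,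
      (∀ x, TwoPlectic.IsHamiltonianVF ϖ (γ₁ x) (ρ x)) →
      ∃ γ : TwoPlectic.Cochain2 E M g ℝ,
        TwoPlectic.IsStandardMomentMap ϖ ρ p γ₁ γ ∧
        ∀ (h : Type*) [AddCommGroup h] [Module ℝ h] [FiniteDimensional ℝ h]
          (L : TwoPlectic.Lie2Brackets g h), L.IsLie2Algebra → L.IsMinimal →
          (∀ x y : g, L.br x y = ⁅x, y⁆) →
          ∀ μ : TwoPlectic.Cochain2 E M g h, TwoPlectic.IsMomentMap ϖ ρ L μ →
            ∃ (f : TwoPlectic.Lie2Hom L (TwoPlectic.pointExt ϖ ρ p))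
              (φ : TwoPlectic.Cochain2 E M g h),
              (∀ x, f.f1g x = x) ∧
              TwoPlectic.IsMomentMap ϖ ρ L φ ∧
              TwoPlectic.IsComp φ γ f ∧
              TwoPlectic.InnerEquivalent L μ φ := by
  refine ⟨TwoPlectic.pointExt_isLie2Algebra hρ hϖ p, hρ.exists_linear, fun γ₁ hγ₁ => ?_⟩
  obtain ⟨γ₂, hγ₂⟩ := TwoPlectic.exists_gamma_two hρ hϖ hM p hγ₁
  have hγ : TwoPlectic.IsStandardMomentMap ϖ ρ p γ₁ ⟨γ₁, TwoPlectic.constLin E M, γ₂⟩ :=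
    { isMomentMap := TwoPlectic.isMomentMap_standard hρ hϖ hγ₁ (fun x y => (hγ₂ x y).1)
        fun x y => (hγ₂ x y).2
      m1g := rfl
      m1h := fun _ _ => rfl
      d_m2 := fun x y => (hγ₂ x y).1
      m2_base := fun x y => (hγ₂ x y).2 }
  exact ⟨_, hγ, fun h _ _ _ L _ hmin hbr μ hμ =>
    TwoPlectic.exists_factorization hϖ hM hγ₁ hγ hmin hbr hμ⟩
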